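/- Let $A\in\mathbb R^{n\times n}$, $B\in\mathbb R^{n\times m}$, $c\in\mathbb R^n$, $\gamma\in(0,1)$, and consider $x_{k+1}=f(x_k,u_k,\xi_k)=Ax_k+Bu_k+c+\xi_k$ on $\mathbb R^n\times\mathbb R^m$, where the $\xi_k$ are i.i.d. random vectors in $\mathbb R^n$ with finite second moments, mean $\mu$ and covariance $\Sigma$. Let $$\ell(x,u)=\begin{bmatrix}x\\u\end{bmatrix}^{\top}\begin{bmatrix}L_{xx}&L_{xu}\\L_{xu}^\top&L_{uu}\end{bmatrix}\begin{bmatrix}x\\u\end{bmatrix}+2\begin{bmatrix}x\\u\end{bmatrix}^{\top}\begin{bmatrix}L_x\\L_u\end{bmatrix}+L_c ,$$ with $L_{xx}$ symmetric and $L_{uu}\succ0$, satisfy $\ell\ge 0$ on $\mathbb R^n\times\mathbb R^m$, and assume that $(\sqrt\gamma A,\sqrt\gamma B)$ is stabilizable. For a measurable policy $\pi:\mathbb R^n\to\mathbb R^m$ let $v_\pi(x)=\mathbb E\big[\sum_{k\ge0}\gamma^k\ell(x_k,\pi(x_k))\,\big|\,x_0=x\big]\in[0,\infty]$, let $v^*=\inf_\pi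 v_\pi$, and let $(\mathcal Tv)(x)=\inf_{u\in\mathbb R^m}\{\ell(x,u)+\gamma\,\mathbb E[v(f(x,u,\xi))]\}$ be the Bellman operator. Put $$\tilde A=\begin{bmatrix}A&c+\mu\\0&1\end{bmatrix},\quad \tilde B=\begin{bmatrix}B\\0\end{bmatrix},\quad \tilde L_{xx}=\begin{bmatrix}L_{xx}&L_x\\L_x^\top&L_c\end{bmatrix},\quad \tilde L_{xu}=\begin{bmatrix}L_{xu}\\L_u^\top\end{bmatrix},$$ and consider the augmented algebraic Riccati equation $$\tilde P=\tilde q-\tilde q_\ell\,\tilde q_c^{-1}\tilde q_\ell^\top,\qquad \tilde q=\tilde L_{xx}+\gamma\tilde A^\top\tilde P\tilde A,\quad \tilde q_\ell=\tilde L_{xu}+\gamma\tilde A^\top\tilde P\tilde B,\quad \tilde q_c=L_{uu}+\gamma\tilde B^\top\tilde P\tilde B. \tag{1}$$ Then there is a matrix $\tilde P^*=\begin{bmatrix}P^*&P^*_\ell\\P_\ell^{*\top}&P_c^*\end{bmatrix}\succeq0$ with the following properties. 1. $\tilde P^*$ solves (1), and $\tilde P^*\preceq\tilde P'$ for every solution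 $\tilde P'\succeq0$ of (1). If the pair $\big(\sqrt\gamma(A-BL_{uu}^{-1}L_{xu}^\top),\;L_{xx}-L_{xu}L_{uu}^{-1}L_{xu}^\top\big)$ is detectable, then $\tilde P^*$ is the unique positive semidefinite solution of (1). Moreover $\tilde P^*\succ0$ if and only if the pair $\big(\sqrt\gamma(\tilde A-\tilde BL_{uu}^{-1}\tilde L_{xu}^\top),\;\tilde L_{xx}-\tilde L_{xu}L_{uu}^{-1}\tilde L_{xu}^\top\big)$ is observable, and in that case, too, $\tilde P^*$ is the unique positive semidefinite (hence the unique positive definite) solution of (1). 2. The optimal value function is $$v^*(x)=x^\top P^*x+2x^\top P^*_\ell+P^*_c+\frac{\gamma\operatorname{Tr}(P^*\Sigma)}{1-\gamma}.$$ It is non-negative, has finite weighted sup-norm for the weight $1+x^\top x$, and satisfies $\mathcal Tv^*=v^*$. It is the least fixed point of $\mathcal T$ among the non-negative measurable functions with finite weighted sup-norm for this weight, and the only one in this class under the detectability condition of 1. 3. Let $q_c^*=L_{uu}+\gamma B^\top P^*B$, $q_\ell^*=L_{xu}+\gamma A^\top P^*B$ and $q=L_u+\gamma B^\top(P_\ell^*+P^*(c+\mu))$.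 Then $q_c^*\succ0$, and the affine feedback $$\pi^*(x)=-q_c^{*-1}\big(q_\ell^{*\top}x+q\big)$$ is optimal, $v_{\pi^*}=v^*$; for every $x$, $\pi^*(x)$ is the unique minimizer over $u\in\mathbb R^m$ of $\ell(x,u)+\gamma\,\mathbb E[v^*(f(x,u,\xi))]$. -/

import Mathlib

open MeasureTheory ProbabilityTheory Matrix

noncomputable section

namespace AffineLQ

/-- The data of a discounted affine-quadratic stochastic control problem on `ℝⁿ × ℝᵐ`:
dynamics `x⁺ = A x + B u + c + ξ` with `ξ` distributed according to `noise`, stage cost given by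
`Lxx, Lxu, Luu, Lx, Lu, Lc`, discount factor `γ`. -/
structure Data (n m : ℕ) where
  A : Matrix (Fin n) (Fin n) ℝ
  B : Matrix (Fin n) (Fin m) ℝ
  c : Fin n → ℝ
  Lxx : Matrix (Fin n) (Fin n) ℝ
  Lxu : Matrix (Fin n) (Fin m) ℝ
  Luu : Matrix (Fin m) (Fin m) ℝ
  Lx : Fin n → ℝ
  Lu : Fin m → ℝ
  Lc : ℝ
  γ : ℝ
  noise : ProbabilityMeasure (Fin n → ℝ)

/-! ### Linear systems notions -/

/-- All complex eigenvalues lie in the open unit disc. -/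
def IsSchurStable {ι : Type} [Fintype ι] [DecidableEq ι] (F : Matrix ι ι ℝ) : Prop :=
  ∀ z ∈ spectrum ℂ (F.map (algebraMap ℝ ℂ)), ‖z‖ < 1

/-- `(F, G)` is stabilizable (discrete time). -/
def IsStabilizable {ι κ : Type} [Fintype ι] [DecidableEq ι] [Fintype κ]
    (F : Matrix ι ι ℝ) (G : Matrix ι κ ℝ) : Prop :=
  ∃ K : Matrix κ ι ℝ, IsSchurStable (F + G * K)

/-- The pair `(F, C)` with output matrix `C` is detectable (discrete time). -/
def IsDetectable {ι κ : Type} [Fintype ι] [DecidableEq ι] [Fintype κ]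
    (F : Matrix ι ι ℝ) (C : Matrix κ ι ℝ) : Prop :=
  ∃ H : Matrix ι κ ℝ, IsSchurStable (F + H * C)

/-- The pair `(F, C)` with output matrix `C` is observable: only the zero initial state produces
the zero output sequence. -/
def IsObservable {ι κ : Type} [Fintype ι] [DecidableEq ι] [Fintype κ]
    (F : Matrix ι ι ℝ) (C : Matrix κ ι ℝ) : Prop :=
  ∀ x : ι → ℝ, (∀ k : ℕ, C *ᵥ ((F ^ k) *ᵥ x) = 0) → x = 0

/-- Membership in the space of measurable functions with finite `z`-weighted sup-norm. -/
def MemWeighted {n : ℕ} (z : (Fin n → ℝ) → ℝ) (g : (Fin n → ℝ) → ℝ) : Prop :=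
  Measurable g ∧ BddAbove (Set.range fun y => |g y| / z y)

/-- The quadratic weight `z(x) = 1 + xᵀx`. -/
def quadWeight {n : ℕ} (x : Fin n → ℝ) : ℝ := 1 + x ⬝ᵥ x

namespace Data

variable {n m : ℕ} (D : Data n m)

/-! ### The control problem -/

/-- The mean of the noise. -/
def mean : Fin n → ℝ := fun i => ∫ y, y i ∂(D.noise : Measure (Fin n → ℝ))

/-- The covariance matrix of the noise. -/
def covMat : Matrix (Fin n) (Fin n) ℝ :=
  Matrix.of fun i j => covariance (fun y : Fin n → ℝ => y i) (fun y : Fin n → ℝ => y j)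
    (D.noise : Measure (Fin n → ℝ))

/-- The dynamics `f(x,u,ξ) = A x + B u + c + ξ`. -/
def step (x : Fin n → ℝ) (u : Fin m → ℝ) (ξ : Fin n → ℝ) : Fin n → ℝ :=
  D.A *ᵥ x + D.B *ᵥ u + D.c + ξ

/-- The generalized quadratic stage cost. -/
def stageCost (x : Fin n → ℝ) (u : Fin m → ℝ) : ℝ :=
  Sum.elim x u ⬝ᵥ (fromBlocks D.Lxx D.Lxu D.Lxuᵀ D.Luu *ᵥ Sum.elim x u)
    + 2 * (Sum.elim x u ⬝ᵥ Sum.elim D.Lx D.Lu) + D.Lc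

/-- `ℓ(x,u) + γ E[v(f(x,u,ξ))]`. -/
def lookahead (v : (Fin n → ℝ) → ℝ) (x : Fin n → ℝ) (u : Fin m → ℝ) : ℝ :=
  D.stageCost x u + D.γ * ∫ ξ, v (D.step x u ξ) ∂(D.noise : Measure (Fin n → ℝ))

/-- The Bellman operator. It is applied to non-negative functions of at most quadratic growth
only, and the stage cost is non-negative, so that the expectation and the infimum are genuine. -/
def bellman (v : (Fin n → ℝ) → ℝ) (x : Fin n → ℝ) : ℝ :=
  ⨅ u : Fin m → ℝ, D.lookahead v x u

/-- The state at time `k` under the policy `π` from `x`, along the noise realization `ω`. -/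
def traj (π : (Fin n → ℝ) → (Fin m → ℝ)) (x : Fin n → ℝ) (ω : ℕ → Fin n → ℝ) : ℕ → Fin n → ℝ
  | 0 => x
  | k + 1 => D.step (traj π x ω k) (π (traj π x ω k)) (ω k)

/-- The expected discounted infinite-horizon cost `v_π(x)`, with values in `[0, ∞]`; the noise
sequence is i.i.d. with law `noise`. -/
def policyCost (π : (Fin n → ℝ) → (Fin m → ℝ)) (x : Fin n → ℝ) : ENNReal :=
  ∫⁻ ω, ∑' k : ℕ,
      ENNReal.ofReal (D.γ ^ k * D.stageCost (D.traj π x ω k) (π (D.traj π x ω k)))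
    ∂(Measure.infinitePi fun _ : ℕ => (D.noise : Measure (Fin n → ℝ)))

/-- The optimal cost: infimum of `v_π(x)` over measurable deterministic stationary policies. -/
def optimalCost (x : Fin n → ℝ) : ENNReal :=
  ⨅ (π : (Fin n → ℝ) → (Fin m → ℝ)) (_ : Measurable π), D.policyCost π x

/-! ### The augmented Riccati equation -/

/-- `[A, c + μ; 0, 1]` -/
def augA : Matrix (Fin n ⊕ Unit) (Fin n ⊕ Unit) ℝ :=
  fromBlocks D.A (replicateCol Unit (D.c + D.mean)) 0 1

/-- `[B; 0]` -/
def augB : Matrix (Fin n ⊕ Unit) (Fin m) ℝ := fromRows D.B 0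

/-- The symmetric block matrix `[P, p; pᵀ, r]`. -/
def blockSym (P : Matrix (Fin n) (Fin n) ℝ) (p : Fin n → ℝ) (r : ℝ) :
    Matrix (Fin n ⊕ Unit) (Fin n ⊕ Unit) ℝ :=
  fromBlocks P (replicateCol Unit p) (replicateRow Unit p) (Matrix.of fun _ _ => r)

/-- `[Lxx, Lx; Lxᵀ, Lc]` -/
def augLxx : Matrix (Fin n ⊕ Unit) (Fin n ⊕ Unit) ℝ := blockSym D.Lxx D.Lx D.Lc

/-- `[Lxu; Luᵀ]` -/
def augLxu : Matrix (Fin n ⊕ Unit) (Fin m) ℝ := fromRows D.Lxu (replicateRow Unit D.Lu)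

/-- `P̃ = q̃ - q̃_ℓ q̃_c⁻¹ q̃_ℓᵀ` with `q̃ = L̃xx + γ ÃᵀP̃Ã`, `q̃_ℓ = L̃xu + γ ÃᵀP̃B̃`,
`q̃_c = Luu + γ B̃ᵀP̃B̃`. -/
def SolvesARE (P : Matrix (Fin n ⊕ Unit) (Fin n ⊕ Unit) ℝ) : Prop :=
  P = (D.augLxx + D.γ • (D.augAᵀ * P * D.augA))
    - (D.augLxu + D.γ • (D.augAᵀ * P * D.augB))
      * (D.Luu + D.γ • (D.augBᵀ * P * D.augB))⁻¹
      * (D.augLxu + D.γ • (D.augAᵀ * P * D.augB))ᵀ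

/-! ### Closed forms -/

/-- `xᵀPx + 2xᵀp + r + γ Tr(PΣ)/(1-γ)` -/
def quadValue (P : Matrix (Fin n) (Fin n) ℝ) (p : Fin n → ℝ) (r : ℝ) (x : Fin n → ℝ) : ℝ :=
  x ⬝ᵥ (P *ᵥ x) + 2 * (x ⬝ᵥ p) + r + D.γ * (P * D.covMat).trace / (1 - D.γ)

/-- `q_c = Luu + γ BᵀPB` -/
def qc (P : Matrix (Fin n) (Fin n) ℝ) : Matrix (Fin m) (Fin m) ℝ :=
  D.Luu + D.γ • (D.Bᵀ * P * D.B)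

/-- `q_ℓ = Lxu + γ AᵀPB` -/
def ql (P : Matrix (Fin n) (Fin n) ℝ) : Matrix (Fin n) (Fin m) ℝ :=
  D.Lxu + D.γ • (D.Aᵀ * P * D.B)

/-- `q = Lu + γ Bᵀ(p + P(c + μ))` -/
def qAff (P : Matrix (Fin n) (Fin n) ℝ) (p : Fin n → ℝ) : Fin m → ℝ :=
  D.Lu + D.γ • (D.Bᵀ *ᵥ (p + P *ᵥ (D.c + D.mean)))

/-- The affine feedback `π(x) = -q_c⁻¹ (q_ℓᵀ x + q)`. -/
def affPolicy (P : Matrix (Fin n) (Fin n) ℝ) (p : Fin n → ℝ) (x : Fin n → ℝ) : Fin m → ℝ :=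
  -((D.qc P)⁻¹ *ᵥ ((D.ql P)ᵀ *ᵥ x + D.qAff P p))

/-! ### Detectability and observability through the stage cost

The cross term is removed in the usual way, by the input `u = -Luu⁻¹ Lxuᵀ x + w`. -/

/-- `(√γ (A - B Luu⁻¹ Lxuᵀ), Lxx - Lxu Luu⁻¹ Lxuᵀ)` is detectable. -/
def CostDetectable : Prop :=
  IsDetectable (√D.γ • (D.A - D.B * D.Luu⁻¹ * D.Lxuᵀ)) (D.Lxx - D.Lxu * D.Luu⁻¹ * D.Lxuᵀ)

/-- `(√γ (Ã - B̃ Luu⁻¹ L̃xuᵀ), L̃xx - L̃xu Luu⁻¹ L̃xuᵀ)` is observable. -/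
def AugCostObservable : Prop :=
  IsObservable (√D.γ • (D.augA - D.augB * D.Luu⁻¹ * D.augLxuᵀ))
    (D.augLxx - D.augLxu * D.Luu⁻¹ * D.augLxuᵀ)

end Data

end AffineLQ

end

/-! Appending the constant coordinate 1 to the state makes dynamics and cost homogeneous, and
scaling the dynamics by √γ absorbs the discount. What remains is a deterministic undiscounted
linear-quadratic problem, `Data.lq`. The mean of the noise enters its drift. The covariance only
adds a constant: on `value Q s` the Bellman operator is `Q ↦ riccati Q` together with `s ↦ γ (s +
Tr(Q₁₁ Σ))` (`lookahead_value`, `bellman_value`), and the scalar recursion is a contraction.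

For the deterministic problem everything comes from completing the square (`cost_add_form_next`).
Value iteration from 0 is monotone and stays below the cost of a stabilizing feedback, hence
converges to a matrix `P`. This `P` is a fixed point of the Riccati operator and lies below every
other semidefinite one. Along the greedy closed loop the stage costs telescope, and comparison with
the N-step optimum gives `y_Nᵀ P y_N ≤ xᵀPx - xᵀP_N x → 0` (`tendsto_form_orbit`). If moreover the
orbits themselves tend to 0, any semidefinite fixed point is also at most `P` (`eq_of_fixed`). The
orbits do so when `P` is positive definite, or under detectability, because vanishing stage costs
are a vanishing input to a Schur stable recursion (`tendsto_orbit_of_detectable`).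

The stochastic statements follow the same pattern. Value iterates bound from below both the
non-negative Bellman fixed points and the finite-horizon costs of every policy. The greedy feedback
attains the limit, since its finite-horizon costs never exceed it. For uniqueness, the gap between a
fixed point and the value is propagated along the greedy closed loop below a quadratic majorant that
tends to 0 (`eq_value_of_bellman_eq`). -/

section

open Filter Topology

namespace AffineLQ

/-! ### Quadratic forms of real symmetric matrices -/

section Forms

variable {ι κ : Type} [Fintype ι] [Fintype κ]

theorem posSemidef_iff_isSymm {P : Matrix ι ι ℝ} :
    P.PosSemidef ↔ P.IsSymm ∧ ∀ x : ι → ℝ, 0 ≤ x ⬝ᵥ (P *ᵥ x) := by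
  rw [posSemidef_iff_dotProduct_mulVec]
  simp [IsHermitian, IsSymm, conjTranspose_eq_transpose_of_trivial]

theorem posDef_iff_isSymm {P : Matrix ι ι ℝ} :
    P.PosDef ↔ P.IsSymm ∧ ∀ x : ι → ℝ, x ≠ 0 → 0 < x ⬝ᵥ (P *ᵥ x) := by
  rw [posDef_iff_dotProduct_mulVec]
  simp [IsHermitian, IsSymm, conjTranspose_eq_transpose_of_trivial]

theorem _root_.Matrix.PosSemidef.form_nonneg {P : Matrix ι ι ℝ} (hP : P.PosSemidef) (x : ι → ℝ) :
    0 ≤ x ⬝ᵥ (P *ᵥ x) :=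
  (posSemidef_iff_isSymm.1 hP).2 x

theorem _root_.Matrix.PosSemidef.isSymm {P : Matrix ι ι ℝ} (hP : P.PosSemidef) : P.IsSymm :=
  (posSemidef_iff_isSymm.1 hP).1

theorem dotProduct_mulVec_transpose (S : Matrix ι κ ℝ) (x : ι → ℝ) (u : κ → ℝ) :
    u ⬝ᵥ (Sᵀ *ᵥ x) = x ⬝ᵥ (S *ᵥ u) := by
  rw [dotProduct_mulVec, vecMul_transpose, dotProduct_comm]

theorem _root_.Matrix.IsSymm.dotProduct_mulVec_comm {P : Matrix ι ι ℝ} (hP : P.IsSymm)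
    (x y : ι → ℝ) : x ⬝ᵥ (P *ᵥ y) = y ⬝ᵥ (P *ᵥ x) := by
  conv_lhs => rw [← dotProduct_mulVec_transpose, hP.eq]

theorem _root_.Matrix.IsSymm.form_add {P : Matrix ι ι ℝ} (hP : P.IsSymm) (x y : ι → ℝ) :
    (x + y) ⬝ᵥ (P *ᵥ (x + y)) = x ⬝ᵥ (P *ᵥ x) + 2 * (x ⬝ᵥ (P *ᵥ y)) + y ⬝ᵥ (P *ᵥ y) := by
  simp only [mulVec_add, add_dotProduct, dotProduct_add]
  rw [hP.dotProduct_mulVec_comm y x]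
  ring

theorem form_smul (P : Matrix ι ι ℝ) (t : ℝ) (x : ι → ℝ) :
    (t • x) ⬝ᵥ (P *ᵥ (t • x)) = t ^ 2 * (x ⬝ᵥ (P *ᵥ x)) := by
  simp only [mulVec_smul, smul_dotProduct, dotProduct_smul, smul_eq_mul]
  ring

theorem form_conj (P : Matrix ι ι ℝ) (F : Matrix ι κ ℝ) (x : κ → ℝ) :
    x ⬝ᵥ ((Fᵀ * P * F) *ᵥ x) = (F *ᵥ x) ⬝ᵥ (P *ᵥ (F *ᵥ x)) := by
  rw [← mulVec_mulVec, ← mulVec_mulVec, dotProduct_mulVec_transpose, dotProduct_comm]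

theorem isSymm_conj {κ : Type} {P : Matrix ι ι ℝ} (hP : P.IsSymm) (F : Matrix ι κ ℝ) :
    (Fᵀ * P * F).IsSymm := by
  simp [IsSymm, transpose_mul, hP.eq, Matrix.mul_assoc]

/-- Cauchy–Schwarz for a degenerate form: the quadratic polynomial `t ↦` form of `x + t y` is
non-negative, so its discriminant is not positive. -/
theorem _root_.Matrix.PosSemidef.sq_dotProduct_mulVec_le {P : Matrix ι ι ℝ} (hP : P.PosSemidef)
    (x y : ι → ℝ) :
    (x ⬝ᵥ (P *ᵥ y)) ^ 2 ≤ (x ⬝ᵥ (P *ᵥ x)) * (y ⬝ᵥ (P *ᵥ y)) := by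
  have h : ∀ t : ℝ, 0 ≤ (y ⬝ᵥ (P *ᵥ y)) * (t * t) + (2 * (x ⬝ᵥ (P *ᵥ y))) * t
      + x ⬝ᵥ (P *ᵥ x) := by
    intro t
    have := hP.form_nonneg (x + t • y)
    rw [hP.isSymm.form_add, form_smul, mulVec_smul, dotProduct_smul, smul_eq_mul] at this
    linarith
  have := discrim_le_zero h
  rw [discrim] at this
  linarith

/-- Cauchy–Schwarz against the basis vector `e_i` gives `(Py)_i² ≤ P_ii · yᵀPy`, so no square root
of `P` is needed. -/
theorem _root_.Matrix.PosSemidef.tendsto_mulVec_zero {P : Matrix ι ι ℝ} (hP : P.PosSemidef)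
    {y : ℕ → ι → ℝ} (h : Tendsto (fun k => y k ⬝ᵥ (P *ᵥ y k)) atTop (𝓝 0)) :
    Tendsto (fun k => P *ᵥ y k) atTop (𝓝 0) := by
  classical
  rw [tendsto_pi_nhds]
  intro i
  have hsq : Tendsto (fun k => ((P *ᵥ y k) i) ^ 2) atTop (𝓝 0) := by
    refine squeeze_zero (fun k => sq_nonneg _) (fun k => ?_) (by simpa using h.const_mul (P i i))
    have := hP.sq_dotProduct_mulVec_le (Pi.single i 1) (y k)
    simpa using this
  have := hsq.sqrt
  simp only [Real.sqrt_sq_eq_abs, Real.sqrt_zero] at this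
  exact (tendsto_zero_iff_abs_tendsto_zero _).2 this

theorem _root_.Matrix.PosDef.tendsto_zero [DecidableEq ι] {P : Matrix ι ι ℝ} (hP : P.PosDef)
    {y : ℕ → ι → ℝ} (h : Tendsto (fun k => y k ⬝ᵥ (P *ᵥ y k)) atTop (𝓝 0)) :
    Tendsto y atTop (𝓝 0) := by
  have h1 := hP.posSemidef.tendsto_mulVec_zero h
  have h2 : Tendsto (fun k => P⁻¹ *ᵥ (P *ᵥ y k)) atTop (𝓝 (P⁻¹ *ᵥ 0)) :=
    ((continuous_const.matrix_mulVec continuous_id).tendsto _).comp h1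
  have hu : IsUnit P.det := (isUnit_iff_isUnit_det _).1 hP.isUnit
  simpa [mulVec_mulVec, nonsing_inv_mul _ hu] using h2

/-- Polarization; it turns convergence of quadratic forms into convergence of entries. -/
theorem _root_.Matrix.IsSymm.apply_eq_form [DecidableEq ι] {P : Matrix ι ι ℝ} (hP : P.IsSymm)
    (i j : ι) :
    P i j = ((Pi.single i 1 + Pi.single j 1) ⬝ᵥ (P *ᵥ (Pi.single i 1 + Pi.single j 1))
      - (Pi.single i 1 : ι → ℝ) ⬝ᵥ (P *ᵥ Pi.single i 1)
      - (Pi.single j 1 : ι → ℝ) ⬝ᵥ (P *ᵥ Pi.single j 1)) / 2 := by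
  rw [hP.form_add]
  simp
  ring

theorem ext_of_form {P P' : Matrix ι ι ℝ} (hP : P.IsSymm) (hP' : P'.IsSymm)
    (h : ∀ x : ι → ℝ, x ⬝ᵥ (P *ᵥ x) = x ⬝ᵥ (P' *ᵥ x)) : P = P' := by
  classical
  ext i j
  rw [hP.apply_eq_form, hP'.apply_eq_form, h, h, h]

theorem complete_square [DecidableEq κ] {c : Matrix κ κ ℝ} (hc : c.PosDef) (q : Matrix ι ι ℝ)
    (l : Matrix ι κ ℝ) (x : ι → ℝ) (u : κ → ℝ) :
    x ⬝ᵥ (q *ᵥ x) + 2 * (x ⬝ᵥ (l *ᵥ u)) + u ⬝ᵥ (c *ᵥ u)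
      = x ⬝ᵥ ((q - l * c⁻¹ * lᵀ) *ᵥ x)
        + (u - -(c⁻¹ * lᵀ) *ᵥ x) ⬝ᵥ (c *ᵥ (u - -(c⁻¹ * lᵀ) *ᵥ x)) := by
  have hu : IsUnit c.det := (isUnit_iff_isUnit_det _).1 hc.isUnit
  have hk : c *ᵥ ((c⁻¹ * lᵀ) *ᵥ x) = lᵀ *ᵥ x := by
    rw [mulVec_mulVec, ← Matrix.mul_assoc, mul_nonsing_inv _ hu, Matrix.one_mul]
  have hx := dotProduct_mulVec_transpose l x ((c⁻¹ * lᵀ) *ᵥ x)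
  rw [neg_mulVec, sub_neg_eq_add, hc.posSemidef.isSymm.form_add, hk, dotProduct_mulVec_transpose,
    sub_mulVec, dotProduct_sub, Matrix.mul_assoc, ← mulVec_mulVec, hx]
  ring

theorem exists_form_le [DecidableEq ι] (P : Matrix ι ι ℝ) :
    ∃ C, 0 ≤ C ∧ ∀ x : ι → ℝ, |x ⬝ᵥ (P *ᵥ x)| ≤ C * ‖x‖ ^ 2 := by
  refine ⟨∑ i, ∑ j, |P i j|, by positivity, fun x => ?_⟩
  simp only [dotProduct, mulVec, Finset.mul_sum, Finset.sum_mul]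
  refine (Finset.abs_sum_le_sum_abs _ _).trans (Finset.sum_le_sum fun i _ => ?_)
  refine (Finset.abs_sum_le_sum_abs _ _).trans (Finset.sum_le_sum fun j _ => ?_)
  rw [abs_mul, abs_mul]
  have hi : |x i| ≤ ‖x‖ := norm_le_pi_norm x i
  have hj : |x j| ≤ ‖x‖ := norm_le_pi_norm x j
  calc |x i| * (|P i j| * |x j|) = |P i j| * (|x i| * |x j|) := by ring
    _ ≤ |P i j| * (‖x‖ * ‖x‖) := by gcongr
    _ = |P i j| * ‖x‖ ^ 2 := by ring

end Forms

/-! ### Schur stability -/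

section Schur

variable {ι κ : Type} [Fintype ι] [DecidableEq ι]

section

attribute [local instance] Matrix.linftyOpNormedRing Matrix.linftyOpNormedAlgebra

/-- Gelfand's formula over ℂ, with `ρ` chosen between the spectral radius and 1. The operator norm
for the sup norm is used because it does not change under complexification. -/
theorem IsSchurStable.exists_norm_pow_mulVec_le {E : Matrix ι ι ℝ} (hE : IsSchurStable E) :
    ∃ c ρ : ℝ, 0 ≤ c ∧ 0 ≤ ρ ∧ ρ < 1 ∧
      ∀ (k : ℕ) (x : ι → ℝ), ‖(E ^ k) *ᵥ x‖ ≤ c * ρ ^ k * ‖x‖ := by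
  rcases isEmpty_or_nonempty ι with hι | hι
  · exact ⟨0, 0, le_rfl, le_rfl, zero_lt_one, fun k x => by
      simp [Subsingleton.elim ((E ^ k) *ᵥ x) 0]⟩
  set a : Matrix ι ι ℂ := E.map (algebraMap ℝ ℂ) with ha
  have hrad : spectralRadius ℂ a < 1 := by
    refine mod_cast spectrum.spectralRadius_lt_of_forall_lt (r := 1) a fun z hz => ?_
    exact_mod_cast hE z hz
  obtain ⟨ρ, hρ1, hρ2⟩ := ENNReal.lt_iff_exists_nnreal_btwn.1 hrad
  have hρlt : ρ < 1 := by exact_mod_cast hρ2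
  have hρpos : 0 < ρ := ENNReal.coe_pos.1 (bot_le.trans_lt hρ1)
  have hev : ∀ᶠ k : ℕ in atTop, ‖a ^ k‖ ≤ (ρ : ℝ) ^ k := by
    have hlim := spectrum.pow_nnnorm_pow_one_div_tendsto_nhds_spectralRadius a
    filter_upwards [hlim.eventually_lt_const hρ1, eventually_gt_atTop 0] with k hk hk0
    have hk' : ((‖a ^ k‖₊ : ENNReal) ^ (1 / k : ℝ)) ^ (k : ℝ) ≤ (ρ : ENNReal) ^ (k : ℝ) :=
      ENNReal.rpow_le_rpow hk.le (by positivity)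
    rw [← ENNReal.rpow_mul, one_div, inv_mul_cancel₀ (by positivity), ENNReal.rpow_one,
      ENNReal.rpow_natCast] at hk'
    exact_mod_cast hk'
  have hO : (fun k : ℕ => a ^ k) =O[atTop] fun k : ℕ => (ρ : ℝ) ^ k :=
    Asymptotics.IsBigO.of_bound 1 (by
      filter_upwards [hev] with k hk
      rwa [one_mul, Real.norm_of_nonneg (pow_nonneg ρ.coe_nonneg k)])
  -- The constant `c` absorbs the finitely many powers for which the eventual bound may fail.
  obtain ⟨c, hc, hb⟩ := Asymptotics.bound_of_isBigO_nat_atTop hO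
  refine ⟨c, ρ, hc.le, ρ.coe_nonneg, hρlt, fun k x => ?_⟩
  have hpow : a ^ k = (E ^ k).map (algebraMap ℝ ℂ) := by
    rw [ha]
    exact (map_pow (algebraMap ℝ ℂ).mapMatrix E k).symm
  have hnorm : ‖a ^ k‖ = ‖E ^ k‖ := by
    rw [hpow, linfty_opNorm_def, linfty_opNorm_def]
    simp
  have h1 := hb (x := k) (pow_ne_zero _ (by exact_mod_cast hρpos.ne'))
  rw [hnorm, Real.norm_of_nonneg (pow_nonneg ρ.coe_nonneg k)] at h1
  exact (linfty_opNorm_mulVec _ _).trans (by gcongr)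

end

theorem isSchurStable_fromBlocks [Fintype κ] [DecidableEq κ] {E : Matrix ι ι ℝ} {d : Matrix ι κ ℝ}
    {e : Matrix κ κ ℝ} (hE : IsSchurStable E) (he : IsSchurStable e) :
    IsSchurStable (fromBlocks E d 0 e) := by
  intro z hz
  rw [fromBlocks_map, mem_spectrum_iff_isRoot_charpoly, Matrix.map_zero _ (map_zero _),
    charpoly_fromBlocks_zero₂₁, Polynomial.root_mul] at hz
  rcases hz with hz | hz
  · exact hE z (mem_spectrum_iff_isRoot_charpoly.2 hz)
  · exact he z (mem_spectrum_iff_isRoot_charpoly.2 hz)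

theorem isSchurStable_smul_one {t : ℝ} (ht0 : 0 ≤ t) (ht : t < 1) :
    IsSchurStable (t • (1 : Matrix Unit Unit ℝ)) := by
  intro z hz
  have h : (t • (1 : Matrix Unit Unit ℝ)).map (algebraMap ℝ ℂ)
      = algebraMap ℂ (Matrix Unit Unit ℂ) (t : ℂ) := by
    ext i j
    simp [algebraMap_matrix_apply]
  rw [h, spectrum.scalar_eq, Set.mem_singleton_iff] at hz
  rw [hz, Complex.norm_real, Real.norm_of_nonneg ht0]
  exact ht

/-- Dominated convergence for series: each term of the convolution, extended by 0, tends to 0 and is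
dominated by `ρ ^ j * C`. -/
theorem tendsto_sum_geometric_mul_zero {ρ : ℝ} (hρ0 : 0 ≤ ρ) (hρ1 : ρ < 1) {e : ℕ → ℝ}
    (he : Tendsto e atTop (𝓝 0)) :
    Tendsto (fun k => ∑ j ∈ Finset.range (k + 1), ρ ^ j * e (k - j)) atTop (𝓝 0) := by
  obtain ⟨C, hC⟩ : ∃ C, ∀ k, |e k| ≤ C := by
    obtain ⟨C, hC⟩ := he.abs.bddAbove_range
    exact ⟨C, fun k => hC ⟨k, rfl⟩⟩
  have h := tendsto_tsum_of_dominated_convergence (𝓕 := atTop)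
    (f := fun (k j : ℕ) => if j ∈ Finset.range (k + 1) then ρ ^ j * e (k - j) else 0)
    (g := fun _ => 0) (bound := fun j => ρ ^ j * C)
    ((summable_geometric_of_lt_one hρ0 hρ1).mul_right C)
    (fun j => by
      have : Tendsto (fun k => ρ ^ j * e (k - j)) atTop (𝓝 (ρ ^ j * 0)) :=
        (he.comp (tendsto_sub_atTop_nat j)).const_mul _
      rw [mul_zero] at this
      refine this.congr' ?_
      filter_upwards [eventually_ge_atTop j] with k hk
      rw [if_pos (Finset.mem_range.2 (by omega))])
    (Eventually.of_forall fun k j => by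
      split_ifs
      · rw [Real.norm_eq_abs, abs_mul, abs_of_nonneg (pow_nonneg hρ0 _)]
        gcongr
        exact hC _
      · rw [norm_zero]
        exact mul_nonneg (pow_nonneg hρ0 _) ((abs_nonneg _).trans (hC 0)))
  rw [tsum_zero] at h
  refine h.congr fun k => ?_
  rw [tsum_eq_sum (s := Finset.range (k + 1)) fun j hj => if_neg hj]
  exact Finset.sum_congr rfl fun j hj => if_pos hj

theorem IsSchurStable.tendsto_zero {E : Matrix ι ι ℝ} (hE : IsSchurStable E) {y d : ℕ → ι → ℝ}
    (hy : ∀ k, y (k + 1) = E *ᵥ y k + d k) (hd : Tendsto d atTop (𝓝 0)) :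
    Tendsto y atTop (𝓝 0) := by
  obtain ⟨c, ρ, hc, hρ0, hρ1, hb⟩ := hE.exists_norm_pow_mulVec_le
  -- Variation of constants: treating the initial state as the input before time 0 makes `y` a
  -- single convolution of `e` with the powers of `E`.
  let e : ℕ → ι → ℝ := fun k => Nat.casesOn k (y 0) d
  have he : Tendsto (fun k => c * ‖e k‖) atTop (𝓝 0) := by
    have : Tendsto e atTop (𝓝 0) := (tendsto_add_atTop_iff_nat 1).1 hd
    simpa using this.norm.const_mul c
  have hsum : ∀ k, y k = ∑ j ∈ Finset.range (k + 1), (E ^ j) *ᵥ e (k - j) := by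
    intro k
    induction k with
    | zero => simp [e]
    | succ k ih =>
      rw [hy, ih, Finset.sum_range_succ' _ (k + 1), mulVec_sum]
      congr 1
      · refine Finset.sum_congr rfl fun j _ => ?_
        rw [mulVec_mulVec, ← pow_succ', Nat.add_sub_add_right]
      · simp [e]
  refine squeeze_zero_norm (fun k => ?_) (tendsto_sum_geometric_mul_zero hρ0 hρ1 he)
  rw [hsum]
  refine (norm_sum_le _ _).trans (Finset.sum_le_sum fun j _ => (hb _ _).trans (le_of_eq (by ring)))

/-- The deviation from the fixed point of `s = ρ (s + β)` obeys a 1×1 Schur stable recursion with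
vanishing input. -/
theorem tendsto_of_affine_recursion {ρ : ℝ} (hρ0 : 0 ≤ ρ) (hρ1 : ρ < 1) {s b : ℕ → ℝ} {β : ℝ}
    (hs : ∀ k, s (k + 1) = ρ * (s k + b k)) (hb : Tendsto b atTop (𝓝 β)) :
    Tendsto s atTop (𝓝 (ρ * β / (1 - ρ))) := by
  have h1 : (1 - ρ) ≠ 0 := by linarith
  have h := (isSchurStable_smul_one hρ0 hρ1).tendsto_zero
    (y := fun k _ => s k - ρ * β / (1 - ρ)) (d := fun k _ => ρ * (b k - β))
    (fun k => by
      ext i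
      simp only [hs, smul_mulVec, one_mulVec, Pi.add_apply, Pi.smul_apply, smul_eq_mul]
      field_simp
      ring)
    (by
      rw [tendsto_pi_nhds]
      intro _
      simpa using (hb.sub_const β).const_mul ρ)
  have := (tendsto_pi_nhds.1 h ()).add_const (ρ * β / (1 - ρ))
  simpa using this

end Schur

/-! ### Undiscounted deterministic linear-quadratic problems -/

/-- Dynamics `x⁺ = F x + G u` with stage cost `xᵀQx + 2xᵀSu + uᵀRu`. -/
structure LinQuad (ι κ : Type) where
  F : Matrix ι ι ℝ
  G : Matrix ι κ ℝ
  Q : Matrix ι ι ℝ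
  S : Matrix ι κ ℝ
  R : Matrix κ κ ℝ

namespace LinQuad

set_option linter.unusedSectionVars false

variable {ι κ : Type} [Fintype ι] [DecidableEq ι] [Fintype κ] [DecidableEq κ] (L : LinQuad ι κ)

/-- The stage cost. -/
def cost (x : ι → ℝ) (u : κ → ℝ) : ℝ :=
  x ⬝ᵥ (L.Q *ᵥ x) + 2 * (x ⬝ᵥ (L.S *ᵥ u)) + u ⬝ᵥ (L.R *ᵥ u)

/-- The successor state. -/
def next (x : ι → ℝ) (u : κ → ℝ) : ι → ℝ := L.F *ᵥ x + L.G *ᵥ u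

/-- The input weight `R + GᵀPG` of the one-step lookahead. -/
def qu (P : Matrix ι ι ℝ) : Matrix κ κ ℝ := L.R + L.Gᵀ * P * L.G

/-- The cross weight `S + FᵀPG` of the one-step lookahead. -/
def qx (P : Matrix ι ι ℝ) : Matrix ι κ ℝ := L.S + L.Fᵀ * P * L.G

/-- The greedy feedback gain. -/
noncomputable def gain (P : Matrix ι ι ℝ) : Matrix κ ι ℝ := -((L.qu P)⁻¹ * (L.qx P)ᵀ)

/-- The Riccati operator. -/
noncomputable def riccati (P : Matrix ι ι ℝ) : Matrix ι ι ℝ :=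
  (L.Q + L.Fᵀ * P * L.F) - L.qx P * (L.qu P)⁻¹ * (L.qx P)ᵀ

/-- The standing assumptions: symmetric state weight, positive definite input weight, non-negative
stage cost. -/
structure Admissible : Prop where
  symm : L.Q.IsSymm
  posDef : L.R.PosDef
  nonneg : ∀ x u, 0 ≤ L.cost x u

/-- The closed loop matrix of a feedback gain. -/
def closedLoop (K : Matrix κ ι ℝ) : Matrix ι ι ℝ := L.F + L.G * K

/-- Value iteration from zero. -/
noncomputable def iter (N : ℕ) : Matrix ι ι ℝ := L.riccati^[N] 0

variable {L}

theorem closedLoop_mulVec (K : Matrix κ ι ℝ) (x : ι → ℝ) :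
    L.closedLoop K *ᵥ x = L.next x (K *ᵥ x) := by
  rw [closedLoop, next, add_mulVec, mulVec_mulVec]

theorem closedLoop_pow_succ_mulVec (K : Matrix κ ι ℝ) (x : ι → ℝ) (k : ℕ) :
    (L.closedLoop K ^ (k + 1)) *ᵥ x
      = L.next ((L.closedLoop K ^ k) *ᵥ x) (K *ᵥ ((L.closedLoop K ^ k) *ᵥ x)) := by
  rw [← closedLoop_mulVec, mulVec_mulVec, pow_succ']

theorem iter_succ (N : ℕ) : L.iter (N + 1) = L.riccati (L.iter N) :=
  Function.iterate_succ_apply' _ _ _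

/-! ### One step of dynamic programming. -/

theorem Admissible.qu_posDef (hL : L.Admissible) {P : Matrix ι ι ℝ} (hP : P.PosSemidef) :
    (L.qu P).PosDef := by
  refine hL.posDef.add_posSemidef ?_
  simpa [conjTranspose_eq_transpose_of_trivial] using hP.conjTranspose_mul_mul_same L.G

/-- The one-step lookahead is a quadratic form in `(x, u)`. Completing the square in `u` splits it
into its minimum, the Riccati image, and a penalty for deviating from the greedy input. -/
theorem Admissible.cost_add_form_next (hL : L.Admissible) {P : Matrix ι ι ℝ} (hP : P.PosSemidef)
    (x : ι → ℝ) (u : κ → ℝ) :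
    L.cost x u + L.next x u ⬝ᵥ (P *ᵥ L.next x u)
      = x ⬝ᵥ (L.riccati P *ᵥ x)
        + (u - L.gain P *ᵥ x) ⬝ᵥ (L.qu P *ᵥ (u - L.gain P *ᵥ x)) := by
  rw [riccati, gain, ← complete_square (hL.qu_posDef hP), next, hP.isSymm.form_add, cost, qu, qx]
  simp only [add_mulVec, dotProduct_add, form_conj]
  rw [← mulVec_mulVec, ← mulVec_mulVec, dotProduct_comm x (L.Fᵀ *ᵥ _), mulVec_transpose,
    ← dotProduct_mulVec, dotProduct_comm (P *ᵥ _)]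
  ring

theorem Admissible.cost_eq (hL : L.Admissible) (x : ι → ℝ) (u : κ → ℝ) :
    L.cost x u = x ⬝ᵥ ((L.Q - L.S * L.R⁻¹ * L.Sᵀ) *ᵥ x)
      + (u + (L.R⁻¹ * L.Sᵀ) *ᵥ x) ⬝ᵥ (L.R *ᵥ (u + (L.R⁻¹ * L.Sᵀ) *ᵥ x)) := by
  rw [cost, complete_square hL.posDef, neg_mulVec, sub_neg_eq_add]

theorem Admissible.form_riccati_le (hL : L.Admissible) {P : Matrix ι ι ℝ} (hP : P.PosSemidef)
    (x : ι → ℝ) (u : κ → ℝ) :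
    x ⬝ᵥ (L.riccati P *ᵥ x) ≤ L.cost x u + L.next x u ⬝ᵥ (P *ᵥ L.next x u) := by
  rw [hL.cost_add_form_next hP]
  exact le_add_of_nonneg_right ((hL.qu_posDef hP).posSemidef.form_nonneg _)

theorem Admissible.form_riccati_eq (hL : L.Admissible) {P : Matrix ι ι ℝ} (hP : P.PosSemidef)
    (x : ι → ℝ) :
    x ⬝ᵥ (L.riccati P *ᵥ x) = L.cost x (L.gain P *ᵥ x)
      + L.next x (L.gain P *ᵥ x) ⬝ᵥ (P *ᵥ L.next x (L.gain P *ᵥ x)) := by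
  rw [hL.cost_add_form_next hP]
  simp

theorem Admissible.riccati_posSemidef (hL : L.Admissible) {P : Matrix ι ι ℝ}
    (hP : P.PosSemidef) : (L.riccati P).PosSemidef := by
  refine posSemidef_iff_isSymm.2 ⟨?_, fun x => ?_⟩
  · have h1 := (hL.qu_posDef hP).inv.posSemidef.isSymm
    have h2 := isSymm_conj h1 (L.qx P)ᵀ
    rw [transpose_transpose] at h2
    exact (hL.symm.add (isSymm_conj hP.isSymm L.F)).sub h2
  · rw [hL.form_riccati_eq hP]
    exact add_nonneg (hL.nonneg _ _) (hP.form_nonneg _)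

/-- The input that is greedy for `P'` is a competitor in the minimization for `P`. -/
theorem Admissible.form_riccati_mono (hL : L.Admissible) {P P' : Matrix ι ι ℝ}
    (hP : P.PosSemidef) (hP' : P'.PosSemidef)
    (h : ∀ x : ι → ℝ, x ⬝ᵥ (P *ᵥ x) ≤ x ⬝ᵥ (P' *ᵥ x)) (x : ι → ℝ) :
    x ⬝ᵥ (L.riccati P *ᵥ x) ≤ x ⬝ᵥ (L.riccati P' *ᵥ x) := by
  rw [hL.form_riccati_eq hP']
  exact (hL.form_riccati_le hP x _).trans (add_le_add_right (h _) _)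

/-! ### Value iteration from zero and its limit. -/

theorem Admissible.iter_posSemidef (hL : L.Admissible) (N : ℕ) : (L.iter N).PosSemidef := by
  induction N with
  | zero => exact PosSemidef.zero
  | succ N ih => rw [iter_succ]; exact hL.riccati_posSemidef ih

theorem Admissible.form_iter_mono (hL : L.Admissible) (x : ι → ℝ) :
    Monotone fun N => x ⬝ᵥ (L.iter N *ᵥ x) := by
  suffices h : ∀ N (x : ι → ℝ), x ⬝ᵥ (L.iter N *ᵥ x) ≤ x ⬝ᵥ (L.iter (N + 1) *ᵥ x) from
    monotone_nat_of_le_succ fun N => h N x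
  intro N
  induction N with
  | zero =>
    intro x
    simpa [iter] using (hL.iter_posSemidef 1).form_nonneg x
  | succ N ih =>
    intro x
    rw [iter_succ, iter_succ (N + 1)]
    exact hL.form_riccati_mono (hL.iter_posSemidef N) (hL.iter_posSemidef _) ih x

theorem Admissible.form_iter_le_of_fixed (hL : L.Admissible) {P : Matrix ι ι ℝ}
    (hP : P.PosSemidef) (hfix : P = L.riccati P) (N : ℕ) (x : ι → ℝ) :
    x ⬝ᵥ (L.iter N *ᵥ x) ≤ x ⬝ᵥ (P *ᵥ x) := by
  induction N generalizing x with
  | zero => simpa [iter] using hP.form_nonneg x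
  | succ N ih =>
    rw [iter_succ, hfix]
    exact hL.form_riccati_mono (hL.iter_posSemidef N) hP ih x

theorem Admissible.form_iter_le_sum (hL : L.Admissible) (N : ℕ) {x : ℕ → ι → ℝ} {u : ℕ → κ → ℝ}
    (hx : ∀ k, x (k + 1) = L.next (x k) (u k)) :
    x 0 ⬝ᵥ (L.iter N *ᵥ x 0) ≤ ∑ k ∈ Finset.range N, L.cost (x k) (u k) := by
  induction N generalizing x u with
  | zero => simp [iter]
  | succ N ih =>
    -- The outermost Riccati step belongs to time 0, so the first stage is split off and the
    -- induction hypothesis is used for the shifted trajectory.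
    rw [iter_succ, Finset.sum_range_succ', add_comm]
    refine (hL.form_riccati_le (hL.iter_posSemidef N) _ (u 0)).trans (add_le_add_right ?_ _)
    rw [← hx 0]
    exact ih (x := fun k => x (k + 1)) (u := fun k => u (k + 1)) fun k => hx (k + 1)

theorem exists_cost_le (K : Matrix κ ι ℝ) :
    ∃ C, 0 ≤ C ∧ ∀ x : ι → ℝ, L.cost x (K *ᵥ x) ≤ C * ‖x‖ ^ 2 := by
  obtain ⟨C, hC, h⟩ := exists_form_le (L.Q + (2 : ℝ) • (L.S * K) + Kᵀ * L.R * K)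
  refine ⟨C, hC, fun x => ?_⟩
  have := (le_abs_self _).trans (h x)
  rw [add_mulVec, add_mulVec, dotProduct_add, dotProduct_add, form_conj, smul_mulVec,
    dotProduct_smul, ← mulVec_mulVec, smul_eq_mul] at this
  exact this

/-- Under a stabilizing feedback the stage costs decay like `ρ ^ (2k)`; their total bounds every
finite-horizon optimum. -/
theorem Admissible.bddAbove_form_iter (hL : L.Admissible) (hstab : IsStabilizable L.F L.G)
    (x : ι → ℝ) : BddAbove (Set.range fun N => x ⬝ᵥ (L.iter N *ᵥ x)) := by
  obtain ⟨K, hK⟩ := hstab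
  obtain ⟨c, ρ, hc, hρ0, hρ1, hb⟩ := hK.exists_norm_pow_mulVec_le
  obtain ⟨C, hC, hcost⟩ := L.exists_cost_le K
  have hρ2 : ρ ^ 2 < 1 := by nlinarith
  have hsum : Summable fun k : ℕ => C * (c * ‖x‖) ^ 2 * (ρ ^ 2) ^ k :=
    (summable_geometric_of_lt_one (sq_nonneg ρ) hρ2).mul_left _
  refine ⟨∑' k : ℕ, C * (c * ‖x‖) ^ 2 * (ρ ^ 2) ^ k, ?_⟩
  rintro _ ⟨N, rfl⟩
  have h1 := hL.form_iter_le_sum N (x := fun k => (L.closedLoop K ^ k) *ᵥ x)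
    (u := fun k => K *ᵥ ((L.closedLoop K ^ k) *ᵥ x)) (closedLoop_pow_succ_mulVec K x)
  simp only [pow_zero, one_mulVec] at h1
  refine h1.trans (le_trans (Finset.sum_le_sum fun k _ => ?_)
    (hsum.sum_le_tsum _ fun k _ => by positivity))
  calc L.cost _ _ ≤ C * ‖(L.closedLoop K ^ k) *ᵥ x‖ ^ 2 := hcost _
    _ ≤ C * (c * ρ ^ k * ‖x‖) ^ 2 := by gcongr; exact hb k x
    _ = C * (c * ‖x‖) ^ 2 * (ρ ^ 2) ^ k := by ring

theorem Admissible.exists_tendsto_iter (hL : L.Admissible) (hstab : IsStabilizable L.F L.G) :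
    ∃ P, Tendsto L.iter atTop (𝓝 P) := by
  have hlim : ∀ x : ι → ℝ, ∃ a, Tendsto (fun N => x ⬝ᵥ (L.iter N *ᵥ x)) atTop (𝓝 a) := fun x =>
    ⟨_, tendsto_atTop_ciSup (hL.form_iter_mono x) (hL.bddAbove_form_iter hstab x)⟩
  choose a ha using hlim
  refine ⟨Matrix.of fun i j => (a (Pi.single i 1 + Pi.single j 1) - a (Pi.single i 1)
    - a (Pi.single j 1)) / 2, ?_⟩
  refine tendsto_pi_nhds.2 fun i => tendsto_pi_nhds.2 fun j => ?_
  refine ((((ha _).sub (ha _)).sub (ha _)).div_const 2).congr fun N => ?_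
  exact ((hL.iter_posSemidef N).isSymm.apply_eq_form i j).symm

theorem tendsto_form {P : Matrix ι ι ℝ} {p : ℕ → Matrix ι ι ℝ} (h : Tendsto p atTop (𝓝 P))
    (x : ι → ℝ) : Tendsto (fun N => x ⬝ᵥ (p N *ᵥ x)) atTop (𝓝 (x ⬝ᵥ (P *ᵥ x))) :=
  ((continuous_const.dotProduct
    (continuous_id.matrix_mulVec continuous_const)).tendsto P).comp h

/-- `P` is the limit of value iteration from zero. -/
def IsValue (L : LinQuad ι κ) (P : Matrix ι ι ℝ) : Prop := Tendsto L.iter atTop (𝓝 P)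

variable {P : Matrix ι ι ℝ}

theorem IsValue.posSemidef (hL : L.Admissible) (hP : L.IsValue P) : P.PosSemidef := by
  refine posSemidef_iff_isSymm.2 ⟨?_, fun x => ?_⟩
  · have h1 : Tendsto (fun N => (L.iter N)ᵀ) atTop (𝓝 Pᵀ) :=
      (continuous_id.matrix_transpose.tendsto P).comp hP
    refine tendsto_nhds_unique (h1.congr fun N => ?_) hP
    exact (hL.iter_posSemidef N).isSymm
  · exact ge_of_tendsto' (tendsto_form hP x) fun N => (hL.iter_posSemidef N).form_nonneg x

/-- The Riccati operator is continuous at `P`, because `qu P` is positive definite and inversion is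
continuous there. -/
theorem IsValue.eq_riccati (hL : L.Admissible) (hP : L.IsValue P) : P = L.riccati P := by
  have hc : ContinuousAt L.riccati P := by
    have hqu : Continuous L.qu := by unfold qu; fun_prop
    have hqx : Continuous L.qx := by unfold qx; fun_prop
    have hdet : IsUnit (L.qu P).det :=
      (isUnit_iff_isUnit_det _).1 (hL.qu_posDef (hP.posSemidef hL)).isUnit
    have hinv : ContinuousAt (fun P => (L.qu P)⁻¹) P := by
      refine ContinuousAt.comp (g := fun M : Matrix κ κ ℝ => M⁻¹) ?_ hqu.continuousAt
      refine continuousAt_matrix_inv _ ?_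
      simpa using NormedRing.inverse_continuousAt hdet.unit
    have h1 : Continuous fun P : Matrix ι ι ℝ => L.Q + L.Fᵀ * P * L.F := by fun_prop
    have hmul : ContinuousAt (fun P => L.qx P * (L.qu P)⁻¹ * (L.qx P)ᵀ) P := by
      have h2 : Continuous fun z : Matrix ι κ ℝ × Matrix κ κ ℝ => z.1 * z.2 * z.1ᵀ := by fun_prop
      exact ContinuousAt.comp (f := fun P => (L.qx P, (L.qu P)⁻¹))
        (g := fun z : Matrix ι κ ℝ × Matrix κ κ ℝ => z.1 * z.2 * z.1ᵀ)
        h2.continuousAt (hqx.continuousAt.prodMk hinv)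
    exact h1.continuousAt.sub hmul
  refine tendsto_nhds_unique ((tendsto_add_atTop_iff_nat 1).2 hP)
    ((hc.tendsto.comp hP).congr fun N => ?_)
  rw [iter_succ]
  rfl

theorem IsValue.form_le_of_fixed (hL : L.Admissible) (hP : L.IsValue P) {P' : Matrix ι ι ℝ}
    (hP' : P'.PosSemidef) (hfix : P' = L.riccati P') (x : ι → ℝ) :
    x ⬝ᵥ (P *ᵥ x) ≤ x ⬝ᵥ (P' *ᵥ x) :=
  le_of_tendsto' (tendsto_form hP x) fun N => hL.form_iter_le_of_fixed hP' hfix N x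

theorem IsValue.sub_posSemidef_of_fixed (hL : L.Admissible) (hP : L.IsValue P)
    {P' : Matrix ι ι ℝ} (hP' : P'.PosSemidef) (hfix : P' = L.riccati P') :
    (P' - P).PosSemidef := by
  refine posSemidef_iff_isSymm.2 ⟨hP'.isSymm.sub (hP.posSemidef hL).isSymm, fun x => ?_⟩
  rw [sub_mulVec, dotProduct_sub, sub_nonneg]
  exact hP.form_le_of_fixed hL hP' hfix x

/-! ### The optimal closed loop. -/

/-- The optimal closed loop state after `k` steps. -/
noncomputable def orbit (L : LinQuad ι κ) (P : Matrix ι ι ℝ) (x : ι → ℝ) (k : ℕ) : ι → ℝ :=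
  (L.closedLoop (L.gain P) ^ k) *ᵥ x

theorem orbit_zero (x : ι → ℝ) : L.orbit P x 0 = x := by simp [orbit]

theorem orbit_succ (x : ι → ℝ) (k : ℕ) :
    L.orbit P x (k + 1) = L.next (L.orbit P x k) (L.gain P *ᵥ L.orbit P x k) :=
  closedLoop_pow_succ_mulVec _ _ _

theorem IsValue.cost_orbit (hL : L.Admissible) (hP : L.IsValue P) (x : ι → ℝ) (k : ℕ) :
    L.cost (L.orbit P x k) (L.gain P *ᵥ L.orbit P x k)
      = L.orbit P x k ⬝ᵥ (P *ᵥ L.orbit P x k)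
        - L.orbit P x (k + 1) ⬝ᵥ (P *ᵥ L.orbit P x (k + 1)) := by
  have h := hL.form_riccati_eq (hP.posSemidef hL) (L.orbit P x k)
  rw [← hP.eq_riccati hL, ← orbit_succ] at h
  linarith

theorem IsValue.sum_cost_orbit (hL : L.Admissible) (hP : L.IsValue P) (x : ι → ℝ) (N : ℕ) :
    ∑ k ∈ Finset.range N, L.cost (L.orbit P x k) (L.gain P *ᵥ L.orbit P x k)
      = x ⬝ᵥ (P *ᵥ x) - L.orbit P x N ⬝ᵥ (P *ᵥ L.orbit P x N) := by
  simp only [hP.cost_orbit hL]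
  rw [Finset.sum_range_sub', orbit_zero]

/-- The first `N` stages of the orbit cost `xᵀPx` minus the terminal form, and at least the N-step
optimum. This uses that `P` is the limit of value iteration, not just a fixed point. -/
theorem IsValue.tendsto_form_orbit (hL : L.Admissible) (hP : L.IsValue P) (x : ι → ℝ) :
    Tendsto (fun N => L.orbit P x N ⬝ᵥ (P *ᵥ L.orbit P x N)) atTop (𝓝 0) := by
  have h1 : Tendsto (fun N => x ⬝ᵥ (P *ᵥ x) - x ⬝ᵥ (L.iter N *ᵥ x)) atTop (𝓝 0) := by
    simpa using (tendsto_form hP x).const_sub (x ⬝ᵥ (P *ᵥ x))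
  refine squeeze_zero (fun N => (hP.posSemidef hL).form_nonneg _) (fun N => ?_) h1
  have h2 := hL.form_iter_le_sum N (orbit_succ (L := L) (P := P) x)
  rw [hP.sum_cost_orbit hL, orbit_zero] at h2
  linarith

theorem IsValue.tendsto_cost_orbit (hL : L.Admissible) (hP : L.IsValue P) (x : ι → ℝ) :
    Tendsto (fun k => L.cost (L.orbit P x k) (L.gain P *ᵥ L.orbit P x k)) atTop (𝓝 0) := by
  have h := hP.tendsto_form_orbit hL x
  simp only [hP.cost_orbit hL]
  simpa using h.sub ((tendsto_add_atTop_iff_nat 1).2 h)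

/-! ### Uniqueness and positive definiteness. -/

theorem Admissible.reducedWeight_posSemidef (hL : L.Admissible) :
    (L.Q - L.S * L.R⁻¹ * L.Sᵀ).PosSemidef := by
  -- The reduced weight is the Riccati image of 0.
  have h := hL.riccati_posSemidef PosSemidef.zero
  simpa [riccati, qx, qu] using h

theorem Admissible.form_le_sum_cost_of_fixed (hL : L.Admissible) {P' : Matrix ι ι ℝ}
    (hP' : P'.PosSemidef) (hfix : P' = L.riccati P') (K : Matrix κ ι ℝ) (x : ι → ℝ) (N : ℕ) :
    x ⬝ᵥ (P' *ᵥ x) ≤ ∑ k ∈ Finset.range N, L.cost ((L.closedLoop K ^ k) *ᵥ x)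
        (K *ᵥ ((L.closedLoop K ^ k) *ᵥ x))
      + ((L.closedLoop K ^ N) *ᵥ x) ⬝ᵥ (P' *ᵥ ((L.closedLoop K ^ N) *ᵥ x)) := by
  induction N with
  | zero => simp
  | succ N ih =>
    have h := hL.form_riccati_le hP' ((L.closedLoop K ^ N) *ᵥ x)
      (K *ᵥ ((L.closedLoop K ^ N) *ᵥ x))
    rw [← hfix, ← closedLoop_pow_succ_mulVec] at h
    rw [Finset.sum_range_succ]
    linarith

/-- Following the feedback of `P`, the form of `P'` is at most the accumulated cost plus a terminal
form. The cost tends to `xᵀPx`, and the terminal form vanishes with the orbit. -/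
theorem IsValue.eq_of_fixed (hL : L.Admissible) (hP : L.IsValue P)
    (horb : ∀ x, Tendsto (L.orbit P x) atTop (𝓝 0)) {P' : Matrix ι ι ℝ}
    (hP' : P'.PosSemidef) (hfix : P' = L.riccati P') : P' = P := by
  refine ext_of_form hP'.isSymm (hP.posSemidef hL).isSymm fun x => ?_
  refine le_antisymm ?_ (hP.form_le_of_fixed hL hP' hfix x)
  have h1 : Tendsto (fun N => L.orbit P x N ⬝ᵥ (P' *ᵥ L.orbit P x N)) atTop (𝓝 0) := by
    have hc : Continuous fun y : ι → ℝ => y ⬝ᵥ (P' *ᵥ y) := by fun_prop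
    have := (hc.tendsto 0).comp (horb x)
    rwa [zero_dotProduct] at this
  have h2 := ((hP.tendsto_form_orbit hL x).const_sub (x ⬝ᵥ (P *ᵥ x))).add h1
  rw [sub_zero, add_zero] at h2
  refine ge_of_tendsto' h2 fun N => ?_
  rw [← hP.sum_cost_orbit hL]
  exact hL.form_le_sum_cost_of_fixed hP' hfix (L.gain P) x N

theorem IsValue.tendsto_orbit_of_posDef (hL : L.Admissible) (hP : L.IsValue P) (hpos : P.PosDef)
    (x : ι → ℝ) : Tendsto (L.orbit P x) atTop (𝓝 0) :=
  hpos.tendsto_zero (hP.tendsto_form_orbit hL x)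

theorem next_eq (x : ι → ℝ) (u : κ → ℝ) :
    L.next x u = (L.F - L.G * L.R⁻¹ * L.Sᵀ) *ᵥ x + L.G *ᵥ (u + (L.R⁻¹ * L.Sᵀ) *ᵥ x) := by
  rw [next, sub_mulVec, mulVec_add, mulVec_mulVec, Matrix.mul_assoc]
  abel

/-- The stage cost is a sum of two non-negative forms, in the output `C y` and in the reduced input
`w`, so both tend to 0. Output injection writes the orbit as `y⁺ = (E + H C) y + (G w - H C y)` with
`E` the reduced dynamics: a stable recursion with vanishing input. -/
theorem IsValue.tendsto_orbit_of_detectable (hL : L.Admissible) (hP : L.IsValue P)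
    (hdet : IsDetectable (L.F - L.G * L.R⁻¹ * L.Sᵀ) (L.Q - L.S * L.R⁻¹ * L.Sᵀ)) (x : ι → ℝ) :
    Tendsto (L.orbit P x) atTop (𝓝 0) := by
  obtain ⟨H, hH⟩ := hdet
  set C := L.Q - L.S * L.R⁻¹ * L.Sᵀ with hC
  set y := L.orbit P x with hy
  let w : ℕ → κ → ℝ := fun k => L.gain P *ᵥ y k + (L.R⁻¹ * L.Sᵀ) *ᵥ y k
  have hcost : ∀ k, L.cost (y k) (L.gain P *ᵥ y k)
      = y k ⬝ᵥ (C *ᵥ y k) + w k ⬝ᵥ (L.R *ᵥ w k) := fun k => hL.cost_eq _ _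
  have hlim := hP.tendsto_cost_orbit hL x
  rw [← hy] at hlim
  have hCpos : C.PosSemidef := hL.reducedWeight_posSemidef
  have hy0 : Tendsto (fun k => C *ᵥ y k) atTop (𝓝 0) := by
    refine hCpos.tendsto_mulVec_zero
      (squeeze_zero (fun k => hCpos.form_nonneg _) (fun k => ?_) hlim)
    rw [hcost]
    exact le_add_of_nonneg_right (hL.posDef.posSemidef.form_nonneg _)
  have hw0 : Tendsto w atTop (𝓝 0) := by
    refine hL.posDef.tendsto_zero
      (squeeze_zero (fun k => hL.posDef.posSemidef.form_nonneg _) (fun k => ?_) hlim)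
    rw [hcost]
    exact le_add_of_nonneg_left (hCpos.form_nonneg _)
  refine hH.tendsto_zero (d := fun k => L.G *ᵥ w k - H *ᵥ (C *ᵥ y k)) (fun k => ?_) ?_
  · rw [hy, orbit_succ, ← hy, next_eq, add_mulVec, ← mulVec_mulVec (y k) H C]
    simp only [w]
    abel
  · have hc : Continuous fun z : (κ → ℝ) × (ι → ℝ) => L.G *ᵥ z.1 - H *ᵥ z.2 := by fun_prop
    have := (hc.tendsto (0, 0)).comp (hw0.prodMk_nhds hy0)
    simp only [mulVec_zero, sub_zero] at this
    exact this

/-- An unobservable state can be steered with `w = 0` at no cost, so its value is 0. Conversely,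
value 0 forces every stage cost along the optimal orbit to vanish, hence `w = 0`, and the orbit is a
free motion with zero output. -/
theorem IsValue.posDef_iff_isObservable (hL : L.Admissible) (hP : L.IsValue P) :
    P.PosDef ↔ IsObservable (L.F - L.G * L.R⁻¹ * L.Sᵀ) (L.Q - L.S * L.R⁻¹ * L.Sᵀ) := by
  have hPs := hP.posSemidef hL
  have hCpos := hL.reducedWeight_posSemidef
  set C := L.Q - L.S * L.R⁻¹ * L.Sᵀ with hC
  set E := L.F - L.G * L.R⁻¹ * L.Sᵀ with hE
  constructor
  · intro hpos x hx
    by_contra hne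
    have hlt := (posDef_iff_isSymm.1 hpos).2 x hne
    refine hlt.not_ge (le_of_tendsto' (tendsto_form hP x) fun N => ?_)
    have h := hL.form_iter_le_sum N (x := fun k => (E ^ k) *ᵥ x)
      (u := fun k => -((L.R⁻¹ * L.Sᵀ) *ᵥ ((E ^ k) *ᵥ x))) (fun k => by
        rw [next_eq, ← hE, neg_add_cancel, mulVec_zero, add_zero, mulVec_mulVec, pow_succ'])
    simp only [pow_zero, one_mulVec] at h
    refine h.trans (le_of_eq (Finset.sum_eq_zero fun k _ => ?_))
    rw [hL.cost_eq, ← hC, hx k, neg_add_cancel]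
    simp
  · intro hobs
    refine posDef_iff_isSymm.2 ⟨hPs.isSymm, fun x hne => ?_⟩
    refine lt_of_le_of_ne (hPs.form_nonneg x) fun h0 => hne (hobs x ?_)
    have hzero : ∀ k, L.cost (L.orbit P x k) (L.gain P *ᵥ L.orbit P x k) = 0 := by
      intro k
      refine le_antisymm ?_ (hL.nonneg _ _)
      have h1 := hP.sum_cost_orbit hL x (k + 1)
      have h2 := hPs.form_nonneg (L.orbit P x (k + 1))
      have h3 := Finset.single_le_sum
        (f := fun k => L.cost (L.orbit P x k) (L.gain P *ᵥ L.orbit P x k))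
        (fun j _ => hL.nonneg _ _) (Finset.self_mem_range_succ k)
      rw [h1] at h3
      linarith
    have hsplit : ∀ k, C *ᵥ L.orbit P x k = 0 ∧
        L.gain P *ᵥ L.orbit P x k + (L.R⁻¹ * L.Sᵀ) *ᵥ L.orbit P x k = 0 := by
      intro k
      have h1 := hzero k
      rw [hL.cost_eq, ← hC] at h1
      have h2 := hCpos.form_nonneg (L.orbit P x k)
      have h3 := hL.posDef.posSemidef.form_nonneg
        (L.gain P *ᵥ L.orbit P x k + (L.R⁻¹ * L.Sᵀ) *ᵥ L.orbit P x k)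
      constructor
      · have h4 : Tendsto (fun _ : ℕ => L.orbit P x k ⬝ᵥ (C *ᵥ L.orbit P x k)) atTop (𝓝 0) := by
          rw [show L.orbit P x k ⬝ᵥ (C *ᵥ L.orbit P x k) = 0 by linarith]
          exact tendsto_const_nhds
        exact tendsto_nhds_unique tendsto_const_nhds (hCpos.tendsto_mulVec_zero h4)
      · by_contra hne
        have := (posDef_iff_isSymm.1 hL.posDef).2 _ hne
        linarith
    have horb : ∀ k, L.orbit P x k = (E ^ k) *ᵥ x := by
      intro k
      induction k with
      | zero => simp [orbit_zero]
      | succ k ih =>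
        rw [orbit_succ, next_eq, (hsplit k).2, mulVec_zero, add_zero, ih, mulVec_mulVec, pow_succ']
    intro k
    rw [← horb]
    exact (hsplit k).1

end LinQuad

/-! ### The augmented linear-quadratic problem -/

/-- The augmented state `(x, 1)`. -/
def lift {n : ℕ} (x : Fin n → ℝ) : Fin n ⊕ Unit → ℝ := Sum.elim x fun _ => 1

namespace Data

variable {n m : ℕ} (D : Data n m)

/-- The augmented problem, with the discount factor absorbed in the dynamics. -/
noncomputable def lq : LinQuad (Fin n ⊕ Unit) (Fin m) where
  F := √D.γ • D.augA
  G := √D.γ • D.augB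
  Q := D.augLxx
  S := D.augLxu
  R := D.Luu

variable {D}

theorem sqrt_smul_conj {ι₁ ι₂ ι₃ : Type} [Fintype ι₁] (hγ : 0 ≤ D.γ) (E : Matrix ι₁ ι₂ ℝ)
    (P : Matrix ι₁ ι₁ ℝ) (G : Matrix ι₁ ι₃ ℝ) :
    (√D.γ • E)ᵀ * P * (√D.γ • G) = D.γ • (Eᵀ * P * G) := by
  rw [transpose_smul, Matrix.smul_mul, Matrix.smul_mul, Matrix.mul_smul, smul_smul,
    Real.mul_self_sqrt hγ]

theorem lq_qu (hγ : 0 ≤ D.γ) (P : Matrix (Fin n ⊕ Unit) (Fin n ⊕ Unit) ℝ) :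
    D.lq.qu P = D.Luu + D.γ • (D.augBᵀ * P * D.augB) := by
  rw [LinQuad.qu, lq, sqrt_smul_conj hγ]

theorem lq_qx (hγ : 0 ≤ D.γ) (P : Matrix (Fin n ⊕ Unit) (Fin n ⊕ Unit) ℝ) :
    D.lq.qx P = D.augLxu + D.γ • (D.augAᵀ * P * D.augB) := by
  rw [LinQuad.qx, lq, sqrt_smul_conj hγ]

theorem solvesARE_iff (hγ : 0 ≤ D.γ) {P : Matrix (Fin n ⊕ Unit) (Fin n ⊕ Unit) ℝ} :
    D.SolvesARE P ↔ P = D.lq.riccati P := by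
  rw [SolvesARE, LinQuad.riccati, lq_qu hγ, lq_qx hγ]
  simp only [lq]
  rw [sqrt_smul_conj hγ]

theorem blockSym_mulVec (P : Matrix (Fin n) (Fin n) ℝ) (p : Fin n → ℝ) (r : ℝ) (x : Fin n → ℝ)
    (t : ℝ) : blockSym P p r *ᵥ Sum.elim x (fun _ => t)
      = Sum.elim (P *ᵥ x + t • p) (fun _ => p ⬝ᵥ x + r * t) := by
  rw [blockSym, fromBlocks_mulVec]
  congr 1
  · ext i
    simp [mulVec, dotProduct, mul_comm]
  · ext i
    simp [mulVec, dotProduct]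

theorem form_blockSym (P : Matrix (Fin n) (Fin n) ℝ) (p : Fin n → ℝ) (r : ℝ) (x : Fin n → ℝ)
    (t : ℝ) : Sum.elim x (fun _ => t) ⬝ᵥ (blockSym P p r *ᵥ Sum.elim x (fun _ => t))
      = x ⬝ᵥ (P *ᵥ x) + 2 * t * (x ⬝ᵥ p) + r * t ^ 2 := by
  rw [blockSym_mulVec, sumElim_dotProduct_sumElim, dotProduct_add, dotProduct_smul,
    dotProduct_comm p x]
  simp [dotProduct]
  ring

theorem augLxu_mulVec (u : Fin m → ℝ) :
    D.augLxu *ᵥ u = Sum.elim (D.Lxu *ᵥ u) fun _ => D.Lu ⬝ᵥ u := by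
  rw [augLxu, fromRows_mulVec]
  rfl

theorem lq_cost (x : Fin n → ℝ) (t : ℝ) (u : Fin m → ℝ) :
    D.lq.cost (Sum.elim x fun _ => t) u = x ⬝ᵥ (D.Lxx *ᵥ x) + 2 * (x ⬝ᵥ (D.Lxu *ᵥ u))
      + u ⬝ᵥ (D.Luu *ᵥ u) + 2 * t * (x ⬝ᵥ D.Lx + u ⬝ᵥ D.Lu) + D.Lc * t ^ 2 := by
  simp only [LinQuad.cost, lq]
  rw [augLxx, form_blockSym, augLxu_mulVec, sumElim_dotProduct_sumElim, dotProduct_comm D.Lu u]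
  simp [dotProduct]
  ring

theorem stageCost_eq (x : Fin n → ℝ) (u : Fin m → ℝ) :
    D.stageCost x u = x ⬝ᵥ (D.Lxx *ᵥ x) + 2 * (x ⬝ᵥ (D.Lxu *ᵥ u))
      + u ⬝ᵥ (D.Luu *ᵥ u) + 2 * (x ⬝ᵥ D.Lx + u ⬝ᵥ D.Lu) + D.Lc := by
  rw [stageCost, fromBlocks_mulVec, sumElim_dotProduct_sumElim, sumElim_dotProduct_sumElim]
  simp only [Sum.elim_comp_inl, Sum.elim_comp_inr, dotProduct_add, dotProduct_mulVec_transpose]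
  ring

theorem lq_cost_lift (x : Fin n → ℝ) (u : Fin m → ℝ) :
    D.lq.cost (lift x) u = D.stageCost x u := by
  rw [lift, lq_cost, stageCost_eq]
  ring

theorem lq_cost_eq_sq_mul {t : ℝ} (ht : t ≠ 0) (x : Fin n → ℝ) (u : Fin m → ℝ) :
    D.lq.cost (Sum.elim x fun _ => t) u = t ^ 2 * D.stageCost (t⁻¹ • x) (t⁻¹ • u) := by
  rw [lq_cost, stageCost_eq]
  simp only [mulVec_smul, smul_dotProduct, dotProduct_smul, smul_eq_mul]
  field_simp

/-- Where the last coordinate `t` is non-zero, homogeneity reduces to the original stage cost; `t =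
0` follows by continuity. -/
theorem lq_cost_nonneg (hcost : ∀ x u, 0 ≤ D.stageCost x u) (x : Fin n ⊕ Unit → ℝ)
    (u : Fin m → ℝ) : 0 ≤ D.lq.cost x u := by
  obtain ⟨y, t, rfl⟩ : ∃ (y : Fin n → ℝ) (t : ℝ), x = Sum.elim y fun _ => t :=
    ⟨x ∘ Sum.inl, x (Sum.inr ()), (Sum.elim_comp_inl_inr x).symm⟩
  have hne : ∀ s : ℝ, s ≠ 0 → 0 ≤ D.lq.cost (Sum.elim y fun _ => s) u := fun s hs => by
    rw [lq_cost_eq_sq_mul hs]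
    exact mul_nonneg (sq_nonneg _) (hcost _ _)
  have hc : Continuous fun s : ℝ => D.lq.cost (Sum.elim y fun _ => s) u := by
    simp only [lq_cost]
    fun_prop
  exact ge_of_tendsto
    (hc.continuousAt.tendsto.mono_left nhdsWithin_le_nhds : Tendsto _ (𝓝[≠] t) _)
    (by
      by_cases ht : t = 0
      · subst ht
        filter_upwards [self_mem_nhdsWithin] with s hs using hne s hs
      · exact ((eventually_ne_nhds ht).filter_mono nhdsWithin_le_nhds).mono hne)

theorem isSymm_blockSym {P : Matrix (Fin n) (Fin n) ℝ} (hP : P.IsSymm) (p : Fin n → ℝ) (r : ℝ) :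
    (blockSym P p r).IsSymm := by
  rw [blockSym]
  exact hP.fromBlocks (by ext; rfl) (by ext; rfl)

theorem exists_eq_blockSym {P : Matrix (Fin n ⊕ Unit) (Fin n ⊕ Unit) ℝ} (hP : P.IsSymm) :
    ∃ (P' : Matrix (Fin n) (Fin n) ℝ) (p : Fin n → ℝ) (r : ℝ), P = blockSym P' p r := by
  refine ⟨P.toBlocks₁₁, fun i => P (Sum.inl i) (Sum.inr ()), P (Sum.inr ()) (Sum.inr ()), ?_⟩
  ext i j
  rcases i with i | i <;> rcases j with j | j
  · rfl
  · rfl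
  · exact hP.apply _ _
  · rfl

theorem lq_admissible (hLxx : D.Lxx.IsSymm) (hLuu : D.Luu.PosDef)
    (hcost : ∀ x u, 0 ≤ D.stageCost x u) : D.lq.Admissible where
  symm := isSymm_blockSym hLxx _ _
  posDef := hLuu
  nonneg := lq_cost_nonneg hcost

theorem isSchurStable_sqrt (hγ1 : D.γ < 1) : IsSchurStable (√D.γ • (1 : Matrix Unit Unit ℝ)) :=
  isSchurStable_smul_one (Real.sqrt_nonneg _) (by rw [Real.sqrt_lt' one_pos]; simpa using hγ1)

/-- The constant coordinate cannot be controlled, but it only contributes the eigenvalue √γ < 1 of a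
block triangular closed loop. -/
theorem lq_isStabilizable (hγ1 : D.γ < 1) (hstab : IsStabilizable (√D.γ • D.A) (√D.γ • D.B)) :
    IsStabilizable D.lq.F D.lq.G := by
  obtain ⟨K, hK⟩ := hstab
  refine ⟨fromCols K 0, ?_⟩
  have h : D.lq.F + D.lq.G * fromCols K 0
      = fromBlocks (√D.γ • D.A + √D.γ • D.B * K)
          (√D.γ • replicateCol Unit (D.c + D.mean)) 0 (√D.γ • 1) := by
    simp only [lq, augA, augB]
    rw [Matrix.smul_mul, fromRows_mul_fromCols, fromBlocks_smul, fromBlocks_smul, fromBlocks_add]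
    simp
  rw [h]
  exact isSchurStable_fromBlocks hK (isSchurStable_sqrt hγ1)

theorem lq_reducedDynamics : D.lq.F - D.lq.G * D.lq.R⁻¹ * D.lq.Sᵀ
    = √D.γ • (D.augA - D.augB * D.Luu⁻¹ * D.augLxuᵀ) := by
  simp only [lq, Matrix.smul_mul, smul_sub]

theorem lq_isDetectable (hγ1 : D.γ < 1) (hdet : D.CostDetectable) :
    IsDetectable (D.lq.F - D.lq.G * D.lq.R⁻¹ * D.lq.Sᵀ)
      (D.lq.Q - D.lq.S * D.lq.R⁻¹ * D.lq.Sᵀ) := by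
  obtain ⟨H, hH⟩ := hdet
  refine ⟨fromBlocks H 0 0 0, ?_⟩
  -- The coupling block `d` does not affect the spectrum, so it is left unspecified.
  have h : ∃ d, D.lq.F - D.lq.G * D.lq.R⁻¹ * D.lq.Sᵀ
      + fromBlocks H 0 0 0 * (D.lq.Q - D.lq.S * D.lq.R⁻¹ * D.lq.Sᵀ)
      = fromBlocks (√D.γ • (D.A - D.B * D.Luu⁻¹ * D.Lxuᵀ)
          + H * (D.Lxx - D.Lxu * D.Luu⁻¹ * D.Lxuᵀ)) d 0 (√D.γ • 1) := by
    rw [lq_reducedDynamics]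
    simp only [lq, augA, augB, augLxx, augLxu, blockSym]
    rw [transpose_fromRows, fromRows_mul D.B, fromRows_mul D.Lxu, fromRows_mul_fromCols,
      fromRows_mul_fromCols]
    simp only [sub_eq_add_neg, fromBlocks_neg, fromBlocks_add, fromBlocks_multiply,
      fromBlocks_smul]
    refine ⟨_, fromBlocks_inj.2 ⟨?_, rfl, ?_, ?_⟩⟩ <;> simp
  obtain ⟨d, h⟩ := h
  rw [h]
  exact isSchurStable_fromBlocks hH (isSchurStable_sqrt hγ1)

theorem augA_mulVec_lift (x : Fin n → ℝ) (u : Fin m → ℝ) :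
    D.augA *ᵥ lift x + D.augB *ᵥ u = lift (D.A *ᵥ x + D.B *ᵥ u + D.c + D.mean) := by
  rw [augA, augB, lift, fromBlocks_mulVec, fromRows_mulVec]
  ext i
  rcases i with i | i
  · simp [lift, mulVec, dotProduct]
    ring
  · simp [lift]

theorem lq_next_lift (x : Fin n → ℝ) (u : Fin m → ℝ) :
    D.lq.next (lift x) u = √D.γ • lift (D.A *ᵥ x + D.B *ᵥ u + D.c + D.mean) := by
  rw [← augA_mulVec_lift]
  simp only [LinQuad.next, lq, smul_mulVec, smul_add]

theorem lq_qu_blockSym (hγ : 0 ≤ D.γ) (P : Matrix (Fin n) (Fin n) ℝ) (p : Fin n → ℝ) (r : ℝ) :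
    D.lq.qu (blockSym P p r) = D.qc P := by
  rw [lq_qu hγ, qc, augB, transpose_fromRows, blockSym, fromCols_mul_fromBlocks,
    fromCols_mul_fromRows]
  simp

theorem affPolicy_eq (hγ : 0 ≤ D.γ) {P : Matrix (Fin n) (Fin n) ℝ} (hP : P.IsSymm)
    (p : Fin n → ℝ) (r : ℝ) (x : Fin n → ℝ) :
    D.affPolicy P p x = D.lq.gain (blockSym P p r) *ᵥ lift x := by
  have hx : (D.lq.qx (blockSym P p r))ᵀ *ᵥ lift x = (D.ql P)ᵀ *ᵥ x + D.qAff P p := by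
    have hA : D.augA *ᵥ lift x = lift (D.A *ᵥ x + D.c + D.mean) := by
      simpa using D.augA_mulVec_lift x 0
    have hB : ∀ y t, D.augBᵀ *ᵥ Sum.elim y (fun _ => t) = D.Bᵀ *ᵥ y := fun y t => by
      rw [augB, transpose_fromRows, fromCols_mulVec]
      simp
    have hL : D.augLxuᵀ *ᵥ lift x = D.Lxuᵀ *ᵥ x + D.Lu := by
      rw [augLxu, transpose_fromRows, fromCols_mulVec, lift]
      ext i
      simp [mulVec, dotProduct]
    rw [lq_qx hγ, ql, qAff, transpose_add, transpose_smul, add_mulVec, smul_mulVec,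
      transpose_mul, transpose_mul, transpose_transpose, (isSymm_blockSym hP p r).eq,
      ← mulVec_mulVec, ← mulVec_mulVec, hA, hL, lift, blockSym_mulVec, hB, transpose_add,
      transpose_smul, transpose_mul, transpose_mul, transpose_transpose, hP.eq, add_mulVec,
      smul_mulVec, ← mulVec_mulVec, ← mulVec_mulVec, one_smul, add_assoc (D.A *ᵥ x)]
    simp only [mulVec_add, smul_add]
    abel
  rw [affPolicy, LinQuad.gain, neg_mulVec, ← mulVec_mulVec, hx, lq_qu_blockSym hγ]

end Data

namespace Data

variable {n m : ℕ} (D : Data n m)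

/-! ### Expectations of quadratic functions -/

/-- The quadratic function of the state given by an augmented matrix and an offset. -/
def value (Q : Matrix (Fin n ⊕ Unit) (Fin n ⊕ Unit) ℝ) (s : ℝ) (x : Fin n → ℝ) : ℝ :=
  lift x ⬝ᵥ (Q *ᵥ lift x) + s

/-- The contribution `Tr(PΣ)` of the noise to the expectation of a quadratic function. -/
noncomputable def noiseCost (Q : Matrix (Fin n ⊕ Unit) (Fin n ⊕ Unit) ℝ) : ℝ :=
  (Q.toBlocks₁₁ * D.covMat).trace

theorem value_blockSym (P : Matrix (Fin n) (Fin n) ℝ) (p : Fin n → ℝ) (r s : ℝ) (x : Fin n → ℝ) :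
    value (blockSym P p r) s x = x ⬝ᵥ (P *ᵥ x) + 2 * (x ⬝ᵥ p) + r + s := by
  rw [value, lift, form_blockSym]
  ring

theorem continuous_value (Q : Matrix (Fin n ⊕ Unit) (Fin n ⊕ Unit) ℝ) (s : ℝ) :
    Continuous (value Q s) := by
  have hl : Continuous (lift : (Fin n → ℝ) → Fin n ⊕ Unit → ℝ) := by
    refine continuous_pi fun i => ?_
    rcases i with i | i
    · exact continuous_apply i
    · exact continuous_const
  exact (hl.dotProduct (continuous_const.matrix_mulVec hl)).add continuous_const

variable {D}

theorem continuous_noiseCost : Continuous D.noiseCost := by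
  unfold noiseCost toBlocks₁₁
  refine Continuous.matrix_trace (Continuous.matrix_mul ?_ continuous_const)
  exact continuous_matrix fun i j => continuous_id.matrix_elem _ _

theorem memLp_apply
    (hnoise : MemLp (fun y : Fin n → ℝ => y) 2 (D.noise : Measure (Fin n → ℝ)))
    (i : Fin n) :
    MemLp (fun y : Fin n → ℝ => y i) 2 (D.noise : Measure (Fin n → ℝ)) :=
  (memLp_pi_iff.1 hnoise) i

theorem memLp_centered
    (hnoise : MemLp (fun y : Fin n → ℝ => y) 2 (D.noise : Measure (Fin n → ℝ)))
    (i : Fin n) :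
    MemLp (fun y : Fin n → ℝ => y i - D.mean i) 2 (D.noise : Measure (Fin n → ℝ)) :=
  (memLp_apply hnoise i).sub (memLp_const _)

theorem integral_dotProduct_centered
    (hnoise : MemLp (fun y : Fin n → ℝ => y) 2 (D.noise : Measure (Fin n → ℝ)))
    (a : Fin n → ℝ) :
    Integrable (fun y : Fin n → ℝ => (y - D.mean) ⬝ᵥ a) (D.noise : Measure (Fin n → ℝ)) ∧
      ∫ y : Fin n → ℝ, (y - D.mean) ⬝ᵥ a ∂(D.noise : Measure (Fin n → ℝ)) = 0 := by
  have hi : ∀ i ∈ Finset.univ, Integrable (fun y : Fin n → ℝ => (y - D.mean) i * a i)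
      (D.noise : Measure (Fin n → ℝ)) := fun i _ =>
    ((memLp_centered hnoise i).integrable one_le_two).mul_const _
  refine ⟨integrable_finsetSum _ hi, ?_⟩
  simp only [dotProduct]
  rw [integral_finsetSum _ hi]
  refine Finset.sum_eq_zero fun i _ => ?_
  rw [integral_mul_const]
  simp only [Pi.sub_apply]
  rw [integral_sub ((memLp_apply hnoise i).integrable one_le_two) (integrable_const _)]
  simp [mean]

theorem integral_form_centered
    (hnoise : MemLp (fun y : Fin n → ℝ => y) 2 (D.noise : Measure (Fin n → ℝ)))
    (M : Matrix (Fin n) (Fin n) ℝ) :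
    Integrable (fun y : Fin n → ℝ => (y - D.mean) ⬝ᵥ (M *ᵥ (y - D.mean)))
      (D.noise : Measure (Fin n → ℝ)) ∧
    ∫ y : Fin n → ℝ, (y - D.mean) ⬝ᵥ (M *ᵥ (y - D.mean)) ∂(D.noise : Measure (Fin n → ℝ))
      = (M * D.covMat).trace := by
  have hi : ∀ i j : Fin n, Integrable (fun y : Fin n → ℝ =>
      (y - D.mean) i * (M i j * (y - D.mean) j)) (D.noise : Measure (Fin n → ℝ)) := fun i j => by
    have := ((memLp_centered hnoise i).integrable_mul (memLp_centered hnoise j)).const_mul (M i j)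
    refine this.congr (Eventually.of_forall fun y => ?_)
    simp only [Pi.sub_apply, Pi.mul_apply]
    ring
  simp only [dotProduct, mulVec, Finset.mul_sum]
  refine ⟨integrable_finsetSum _ fun i _ => integrable_finsetSum _ fun j _ => hi i j, ?_⟩
  rw [integral_finsetSum _ fun i _ => integrable_finsetSum _ fun j _ => hi i j]
  simp only [trace, diag, mul_apply]
  refine Finset.sum_congr rfl fun i _ => ?_
  rw [integral_finsetSum _ fun j _ => hi i j]
  refine Finset.sum_congr rfl fun j _ => ?_
  -- The trace pairs `M i j` with the covariance of `j` and `i`, hence the swap.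
  rw [covMat, of_apply, covariance_comm, covariance, ← integral_const_mul]
  refine integral_congr_ae (Eventually.of_forall fun y => ?_)
  simp only [Pi.sub_apply, mean]
  ring

theorem noiseCost_nonneg
    (hnoise : MemLp (fun y : Fin n → ℝ => y) 2 (D.noise : Measure (Fin n → ℝ)))
    {Q : Matrix (Fin n ⊕ Unit) (Fin n ⊕ Unit) ℝ} (hQ : Q.PosSemidef) :
    0 ≤ D.noiseCost Q := by
  rw [noiseCost, ← (integral_form_centered hnoise _).2]
  exact integral_nonneg fun y => (hQ.submatrix Sum.inl).form_nonneg _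

/-- The lifted successor is the lifted mean successor plus centered noise with last coordinate 0.
The cross term has mean zero, and the quadratic term only sees the upper left block. -/
theorem integral_value_step
    (hnoise : MemLp (fun y : Fin n → ℝ => y) 2 (D.noise : Measure (Fin n → ℝ)))
    {Q : Matrix (Fin n ⊕ Unit) (Fin n ⊕ Unit) ℝ} (hQ : Q.IsSymm) (s : ℝ)
    (x : Fin n → ℝ) (u : Fin m → ℝ) :
    Integrable (fun y => value Q s (D.step x u y)) (D.noise : Measure (Fin n → ℝ)) ∧
    ∫ y, value Q s (D.step x u y) ∂(D.noise : Measure (Fin n → ℝ))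
      = value Q s (D.A *ᵥ x + D.B *ᵥ u + D.c + D.mean) + D.noiseCost Q := by
  set z := D.A *ᵥ x + D.B *ᵥ u + D.c + D.mean with hz
  have hlift : ∀ y, lift (D.step x u y) = lift z + Sum.elim (y - D.mean) (fun _ => 0) := by
    intro y
    ext i
    rcases i with i | i
    · simp [lift, step, hz]
    · simp [lift]
  have hval : ∀ y, value Q s (D.step x u y) = value Q s z
      + 2 * ((y - D.mean) ⬝ᵥ ((Q *ᵥ lift z) ∘ Sum.inl))
      + (y - D.mean) ⬝ᵥ (Q.toBlocks₁₁ *ᵥ (y - D.mean)) := by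
    intro y
    have h1 : ∀ (w : Fin n → ℝ) (a : Fin n ⊕ Unit → ℝ),
        Sum.elim w (fun _ => 0) ⬝ᵥ a = w ⬝ᵥ (a ∘ Sum.inl) := fun w a => by
      simp [dotProduct]
    have h2 : ∀ w : Fin n → ℝ, (Q *ᵥ Sum.elim w (fun _ => 0)) ∘ Sum.inl
        = Q.toBlocks₁₁ *ᵥ w := fun w => by
      ext i
      simp [mulVec, dotProduct, toBlocks₁₁]
    rw [value, value, hlift, hQ.form_add, hQ.dotProduct_mulVec_comm (lift z) (Sum.elim _ _), h1,
      h1, h2]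
    ring
  obtain ⟨i1, e1⟩ := integral_dotProduct_centered hnoise ((Q *ᵥ lift z) ∘ Sum.inl)
  obtain ⟨i2, e2⟩ := integral_form_centered hnoise Q.toBlocks₁₁
  simp only [hval]
  have i3 : Integrable (fun y => value Q s z + 2 * ((y - D.mean) ⬝ᵥ ((Q *ᵥ lift z) ∘ Sum.inl)))
      (D.noise : Measure (Fin n → ℝ)) := (integrable_const _).add (i1.const_mul 2)
  refine ⟨i3.add i2, ?_⟩
  rw [integral_add i3 i2, integral_add (integrable_const _) (i1.const_mul 2), integral_const_mul,
    e1, e2, noiseCost]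
  simp

theorem discounted_integral_value
    (hnoise : MemLp (fun y : Fin n → ℝ => y) 2 (D.noise : Measure (Fin n → ℝ)))
    (hγ : 0 ≤ D.γ) {Q : Matrix (Fin n ⊕ Unit) (Fin n ⊕ Unit) ℝ}
    (hQ : Q.IsSymm) (s : ℝ) (x : Fin n → ℝ) (u : Fin m → ℝ) :
    D.γ * ∫ y, value Q s (D.step x u y) ∂(D.noise : Measure (Fin n → ℝ))
      = D.lq.next (lift x) u ⬝ᵥ (Q *ᵥ D.lq.next (lift x) u) + D.γ * (s + D.noiseCost Q) := by
  rw [(integral_value_step hnoise hQ s x u).2, lq_next_lift, form_smul, Real.sq_sqrt hγ, value]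
  ring

theorem lookahead_value
    (hnoise : MemLp (fun y : Fin n → ℝ => y) 2 (D.noise : Measure (Fin n → ℝ)))
    (hγ : 0 ≤ D.γ) (hL : D.lq.Admissible)
    {Q : Matrix (Fin n ⊕ Unit) (Fin n ⊕ Unit) ℝ} (hQ : Q.PosSemidef) (s : ℝ) (x : Fin n → ℝ)
    (u : Fin m → ℝ) :
    D.lookahead (value Q s) x u = value (D.lq.riccati Q) (D.γ * (s + D.noiseCost Q)) x
      + (u - D.lq.gain Q *ᵥ lift x) ⬝ᵥ (D.lq.qu Q *ᵥ (u - D.lq.gain Q *ᵥ lift x)) := by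
  rw [lookahead, discounted_integral_value hnoise hγ hQ.isSymm, ← lq_cost_lift, ← add_assoc,
    hL.cost_add_form_next hQ, value]
  ring

theorem value_riccati_le_lookahead
    (hnoise : MemLp (fun y : Fin n → ℝ => y) 2 (D.noise : Measure (Fin n → ℝ)))
    (hγ : 0 ≤ D.γ) (hL : D.lq.Admissible)
    {Q : Matrix (Fin n ⊕ Unit) (Fin n ⊕ Unit) ℝ} (hQ : Q.PosSemidef) (s : ℝ) (x : Fin n → ℝ)
    (u : Fin m → ℝ) :
    value (D.lq.riccati Q) (D.γ * (s + D.noiseCost Q)) x ≤ D.lookahead (value Q s) x u := by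
  rw [lookahead_value hnoise hγ hL hQ]
  exact le_add_of_nonneg_right ((hL.qu_posDef hQ).posSemidef.form_nonneg _)

theorem lookahead_value_gain
    (hnoise : MemLp (fun y : Fin n → ℝ => y) 2 (D.noise : Measure (Fin n → ℝ)))
    (hγ : 0 ≤ D.γ) (hL : D.lq.Admissible)
    {Q : Matrix (Fin n ⊕ Unit) (Fin n ⊕ Unit) ℝ} (hQ : Q.PosSemidef) (s : ℝ) (x : Fin n → ℝ) :
    D.lookahead (value Q s) x (D.lq.gain Q *ᵥ lift x)
      = value (D.lq.riccati Q) (D.γ * (s + D.noiseCost Q)) x := by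
  rw [lookahead_value hnoise hγ hL hQ]
  simp

theorem bellman_value
    (hnoise : MemLp (fun y : Fin n → ℝ => y) 2 (D.noise : Measure (Fin n → ℝ)))
    (hγ : 0 ≤ D.γ) (hL : D.lq.Admissible)
    {Q : Matrix (Fin n ⊕ Unit) (Fin n ⊕ Unit) ℝ} (hQ : Q.PosSemidef) (s : ℝ) :
    D.bellman (value Q s) = value (D.lq.riccati Q) (D.γ * (s + D.noiseCost Q)) := by
  ext x
  refine le_antisymm ?_ (le_ciInf fun u => value_riccati_le_lookahead hnoise hγ hL hQ s x u)
  rw [← lookahead_value_gain hnoise hγ hL hQ]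
  refine ciInf_le ⟨value (D.lq.riccati Q) (D.γ * (s + D.noiseCost Q)) x, ?_⟩ _
  rintro _ ⟨u, rfl⟩
  exact value_riccati_le_lookahead hnoise hγ hL hQ s x u

theorem lookahead_value_le_iff
    (hnoise : MemLp (fun y : Fin n → ℝ => y) 2 (D.noise : Measure (Fin n → ℝ)))
    (hγ : 0 ≤ D.γ) (hL : D.lq.Admissible)
    {Q : Matrix (Fin n ⊕ Unit) (Fin n ⊕ Unit) ℝ} (hQ : Q.PosSemidef) (s : ℝ) (x : Fin n → ℝ)
    (u : Fin m → ℝ) :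
    (∀ w, D.lookahead (value Q s) x u ≤ D.lookahead (value Q s) x w) ↔
      u = D.lq.gain Q *ᵥ lift x := by
  constructor
  · intro h
    have h1 := h (D.lq.gain Q *ᵥ lift x)
    rw [lookahead_value_gain hnoise hγ hL hQ, lookahead_value hnoise hγ hL hQ] at h1
    by_contra hne
    have := (posDef_iff_isSymm.1 (hL.qu_posDef hQ)).2 _ (sub_ne_zero.2 hne)
    linarith
  · rintro rfl w
    rw [lookahead_value_gain hnoise hγ hL hQ]
    exact value_riccati_le_lookahead hnoise hγ hL hQ s x w

end Data

/-! ### Functions of at most quadratic growth -/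

theorem sq_norm_le_dotProduct {ι : Type} [Fintype ι] (x : ι → ℝ) : ‖x‖ ^ 2 ≤ x ⬝ᵥ x := by
  have h0 : 0 ≤ x ⬝ᵥ x := Finset.sum_nonneg fun i _ => mul_self_nonneg (x i)
  rw [← Real.le_sqrt (norm_nonneg x) h0, pi_norm_le_iff_of_nonneg (Real.sqrt_nonneg _)]
  refine fun i => Real.le_sqrt_of_sq_le ?_
  rw [Real.norm_eq_abs, sq_abs, sq]
  exact Finset.single_le_sum (f := fun i => x i * x i) (fun j _ => mul_self_nonneg (x j))
    (Finset.mem_univ i)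

theorem quadWeight_pos {n : ℕ} (x : Fin n → ℝ) : 0 < quadWeight x := by
  have h0 : 0 ≤ x ⬝ᵥ x := (sq_nonneg _).trans (sq_norm_le_dotProduct x)
  rw [quadWeight]
  linarith

theorem lift_dotProduct_lift {n : ℕ} (x : Fin n → ℝ) : lift x ⬝ᵥ lift x = quadWeight x := by
  rw [lift, sumElim_dotProduct_sumElim, quadWeight]
  simp [dotProduct, add_comm]

theorem memWeighted_iff {n : ℕ} {v : (Fin n → ℝ) → ℝ} :
    MemWeighted quadWeight v ↔ Measurable v ∧ ∃ C, ∀ x, |v x| ≤ C * quadWeight x := by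
  refine and_congr_right fun _ => exists_congr fun C => ?_
  simp only [mem_upperBounds, Set.forall_mem_range, div_le_iff₀ (quadWeight_pos _)]

namespace Data

variable {n m : ℕ} {D : Data n m}

/-- The weight is itself a quadratic value function, so every function in the weighted class has a
majorant to which the quadratic calculus applies. -/
theorem value_smul_one (C : ℝ) (x : Fin n → ℝ) : value (C • 1) 0 x = C * quadWeight x := by
  rw [value, smul_mulVec, one_mulVec, dotProduct_smul, lift_dotProduct_lift, smul_eq_mul, add_zero]

theorem memWeighted_value (Q : Matrix (Fin n ⊕ Unit) (Fin n ⊕ Unit) ℝ) (s : ℝ) :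
    MemWeighted quadWeight (value Q s) := by
  refine memWeighted_iff.2 ⟨(continuous_value Q s).measurable, ?_⟩
  obtain ⟨C, hC, h⟩ := exists_form_le Q
  refine ⟨C + |s|, fun x => ?_⟩
  have h1 : (1 : ℝ) ≤ quadWeight x := by
    have := (sq_nonneg _).trans (sq_norm_le_dotProduct x)
    rw [quadWeight]
    linarith
  calc |value Q s x| ≤ |lift x ⬝ᵥ (Q *ᵥ lift x)| + |s| := abs_add_le _ _
    _ ≤ C * ‖lift x‖ ^ 2 + |s| * 1 := by rw [mul_one]; gcongr; exact h _
    _ ≤ C * quadWeight x + |s| * quadWeight x := by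
      gcongr
      rw [← lift_dotProduct_lift]
      exact sq_norm_le_dotProduct _
    _ = (C + |s|) * quadWeight x := by ring

theorem measurable_step (x : Fin n → ℝ) (u : Fin m → ℝ) : Measurable (D.step x u) := by
  unfold step
  fun_prop

/-! ### Value iteration with noise. -/

/-- The offset accumulated by value iteration from zero because of the noise. -/
noncomputable def offset (D : Data n m) : ℕ → ℝ
  | 0 => 0
  | N + 1 => D.γ * (offset D N + D.noiseCost (D.lq.iter N))

theorem tendsto_offset (hγ0 : 0 ≤ D.γ) (hγ1 : D.γ < 1)
    {P : Matrix (Fin n ⊕ Unit) (Fin n ⊕ Unit) ℝ} (hP : D.lq.IsValue P) :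
    Tendsto D.offset atTop (𝓝 (D.γ * D.noiseCost P / (1 - D.γ))) :=
  tendsto_of_affine_recursion hγ0 hγ1 (fun _ => rfl)
    ((continuous_noiseCost.tendsto P).comp hP)

theorem tendsto_value {P : Matrix (Fin n ⊕ Unit) (Fin n ⊕ Unit) ℝ}
    {p : ℕ → Matrix (Fin n ⊕ Unit) (Fin n ⊕ Unit) ℝ} {s : ℕ → ℝ} {σ : ℝ}
    (hp : Tendsto p atTop (𝓝 P)) (hs : Tendsto s atTop (𝓝 σ)) (x : Fin n → ℝ) :
    Tendsto (fun N => value (p N) (s N) x) atTop (𝓝 (value P σ x)) :=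
  (LinQuad.tendsto_form hp (lift x)).add hs

theorem tendsto_value_iter (hγ0 : 0 ≤ D.γ) (hγ1 : D.γ < 1)
    {P : Matrix (Fin n ⊕ Unit) (Fin n ⊕ Unit) ℝ} (hP : D.lq.IsValue P) (x : Fin n → ℝ) :
    Tendsto (fun N => value (D.lq.iter N) (D.offset N) x) atTop
      (𝓝 (value P (D.γ * D.noiseCost P / (1 - D.γ)) x)) :=
  tendsto_value hP (tendsto_offset hγ0 hγ1 hP) x

theorem lookahead_nonneg (hγ : 0 ≤ D.γ) (hcost : ∀ x u, 0 ≤ D.stageCost x u)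
    {v : (Fin n → ℝ) → ℝ} (hv : ∀ x, 0 ≤ v x) (x : Fin n → ℝ) (u : Fin m → ℝ) :
    0 ≤ D.lookahead v x u :=
  add_nonneg (hcost x u) (mul_nonneg hγ (integral_nonneg fun _ => hv _))

/-- Non-negativity supplies the lower bound without which a real infimum would be a default value.
-/
theorem bellman_le_lookahead (hγ : 0 ≤ D.γ) (hcost : ∀ x u, 0 ≤ D.stageCost x u)
    {v : (Fin n → ℝ) → ℝ} (hv : ∀ x, 0 ≤ v x) (x : Fin n → ℝ) (u : Fin m → ℝ) :
    D.bellman v x ≤ D.lookahead v x u := by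
  refine ciInf_le ⟨0, ?_⟩ u
  rintro _ ⟨w, rfl⟩
  exact lookahead_nonneg hγ hcost hv x w

theorem offset_limit {P : Matrix (Fin n ⊕ Unit) (Fin n ⊕ Unit) ℝ} (hγ1 : D.γ < 1) :
    D.γ * (D.γ * D.noiseCost P / (1 - D.γ) + D.noiseCost P)
      = D.γ * D.noiseCost P / (1 - D.γ) := by
  have : (1 - D.γ) ≠ 0 := by linarith
  field_simp
  ring

theorem integrable_of_memWeighted
    (hnoise : MemLp (fun y : Fin n → ℝ => y) 2 (D.noise : Measure (Fin n → ℝ)))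
    {v : (Fin n → ℝ) → ℝ} (hv : MemWeighted quadWeight v)
    (x : Fin n → ℝ) (u : Fin m → ℝ) :
    Integrable (fun y => v (D.step x u y)) (D.noise : Measure (Fin n → ℝ)) := by
  obtain ⟨hmeas, C, hC⟩ := memWeighted_iff.1 hv
  have hQ : (C • (1 : Matrix (Fin n ⊕ Unit) (Fin n ⊕ Unit) ℝ)).IsSymm := isSymm_one.smul C
  refine (integral_value_step hnoise hQ 0 x u).1.mono'
    (hmeas.comp (measurable_step x u)).aestronglyMeasurable (Eventually.of_forall fun y => ?_)
  rw [value_smul_one]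
  exact hC _

theorem lookahead_mono
    (hnoise : MemLp (fun y : Fin n → ℝ => y) 2 (D.noise : Measure (Fin n → ℝ)))
    (hγ : 0 ≤ D.γ) {v w : (Fin n → ℝ) → ℝ} (hv : MemWeighted quadWeight v)
    (hw : MemWeighted quadWeight w) (h : ∀ x, v x ≤ w x) (x : Fin n → ℝ) (u : Fin m → ℝ) :
    D.lookahead v x u ≤ D.lookahead w x u := by
  unfold lookahead
  gcongr
  · exact integrable_of_memWeighted hnoise hv x u
  · exact integrable_of_memWeighted hnoise hw x u
  · exact fun y => h _

theorem offset_nonneg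
    (hnoise : MemLp (fun y : Fin n → ℝ => y) 2 (D.noise : Measure (Fin n → ℝ)))
    (hγ : 0 ≤ D.γ) (hL : D.lq.Admissible) (N : ℕ) : 0 ≤ D.offset N := by
  induction N with
  | zero => exact le_rfl
  | succ N ih =>
    exact mul_nonneg hγ (add_nonneg ih (noiseCost_nonneg hnoise (hL.iter_posSemidef N)))

theorem value_iter_nonneg
    (hnoise : MemLp (fun y : Fin n → ℝ => y) 2 (D.noise : Measure (Fin n → ℝ)))
    (hγ : 0 ≤ D.γ) (hL : D.lq.Admissible) (N : ℕ) (x : Fin n → ℝ) :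
    0 ≤ value (D.lq.iter N) (D.offset N) x :=
  add_nonneg ((hL.iter_posSemidef N).form_nonneg _) (offset_nonneg hnoise hγ hL N)

theorem value_iter_succ_le_lookahead
    (hnoise : MemLp (fun y : Fin n → ℝ => y) 2 (D.noise : Measure (Fin n → ℝ)))
    (hγ : 0 ≤ D.γ) (hL : D.lq.Admissible) (N : ℕ)
    (x : Fin n → ℝ) (u : Fin m → ℝ) :
    value (D.lq.iter (N + 1)) (D.offset (N + 1)) x
      ≤ D.lookahead (value (D.lq.iter N) (D.offset N)) x u := by
  rw [LinQuad.iter_succ]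
  exact value_riccati_le_lookahead hnoise hγ hL (hL.iter_posSemidef N) _ x u

theorem value_iter_le_of_bellman_eq
    (hnoise : MemLp (fun y : Fin n → ℝ => y) 2 (D.noise : Measure (Fin n → ℝ)))
    (hγ : 0 ≤ D.γ) (hL : D.lq.Admissible)
    {v : (Fin n → ℝ) → ℝ} (hv0 : ∀ x, 0 ≤ v x) (hv : MemWeighted quadWeight v)
    (hfix : D.bellman v = v) (N : ℕ) (x : Fin n → ℝ) :
    value (D.lq.iter N) (D.offset N) x ≤ v x := by
  induction N generalizing x with
  | zero => simpa [value, LinQuad.iter, offset] using hv0 x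
  | succ N ih =>
    rw [← hfix]
    exact le_ciInf fun u => (value_iter_succ_le_lookahead hnoise hγ hL N x u).trans
      (lookahead_mono hnoise hγ (memWeighted_value _ _) hv ih x u)

/-! ### Fixed points of the Bellman operator. -/

section Value

variable {P : Matrix (Fin n ⊕ Unit) (Fin n ⊕ Unit) ℝ}

theorem value_nonneg
    (hnoise : MemLp (fun y : Fin n → ℝ => y) 2 (D.noise : Measure (Fin n → ℝ)))
    (hγ0 : 0 ≤ D.γ) (hγ1 : D.γ < 1) (hP : P.PosSemidef) (x : Fin n → ℝ) :
    0 ≤ value P (D.γ * D.noiseCost P / (1 - D.γ)) x :=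
  add_nonneg (hP.form_nonneg _)
    (div_nonneg (mul_nonneg hγ0 (noiseCost_nonneg hnoise hP)) (by linarith))

theorem bellman_value_eq
    (hnoise : MemLp (fun y : Fin n → ℝ => y) 2 (D.noise : Measure (Fin n → ℝ)))
    (hγ0 : 0 ≤ D.γ) (hγ1 : D.γ < 1) (hL : D.lq.Admissible)
    (hP : D.lq.IsValue P) :
    D.bellman (value P (D.γ * D.noiseCost P / (1 - D.γ)))
      = value P (D.γ * D.noiseCost P / (1 - D.γ)) := by
  rw [bellman_value hnoise hγ0 hL (hP.posSemidef hL), ← hP.eq_riccati hL, offset_limit hγ1]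

theorem lookahead_value_eq
    (hnoise : MemLp (fun y : Fin n → ℝ => y) 2 (D.noise : Measure (Fin n → ℝ)))
    (hγ0 : 0 ≤ D.γ) (hγ1 : D.γ < 1) (hL : D.lq.Admissible)
    (hP : D.lq.IsValue P) (x : Fin n → ℝ) :
    D.lookahead (value P (D.γ * D.noiseCost P / (1 - D.γ))) x (D.lq.gain P *ᵥ lift x)
      = value P (D.γ * D.noiseCost P / (1 - D.γ)) x := by
  rw [lookahead_value_gain hnoise hγ0 hL (hP.posSemidef hL), ← hP.eq_riccati hL,
    offset_limit hγ1]

theorem value_le_of_bellman_eq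
    (hnoise : MemLp (fun y : Fin n → ℝ => y) 2 (D.noise : Measure (Fin n → ℝ)))
    (hγ0 : 0 ≤ D.γ) (hγ1 : D.γ < 1) (hL : D.lq.Admissible)
    (hP : D.lq.IsValue P) {v : (Fin n → ℝ) → ℝ} (hv0 : ∀ x, 0 ≤ v x)
    (hv : MemWeighted quadWeight v) (hfix : D.bellman v = v) (x : Fin n → ℝ) :
    value P (D.γ * D.noiseCost P / (1 - D.γ)) x ≤ v x :=
  le_of_tendsto' (tendsto_value_iter hγ0 hγ1 hP x) fun N =>
    value_iter_le_of_bellman_eq hnoise hγ0 hL hv0 hv hfix N x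

/-- If the optimal closed loop is stable, then a non-negative fixed point of the Bellman operator
exceeds the value function by at most the discounted expectation of its quadratic majorant, which
vanishes in the limit. -/
theorem eq_value_of_bellman_eq
    (hnoise : MemLp (fun y : Fin n → ℝ => y) 2 (D.noise : Measure (Fin n → ℝ)))
    (hγ0 : 0 ≤ D.γ) (hγ1 : D.γ < 1) (hL : D.lq.Admissible)
    (hcost : ∀ x u, 0 ≤ D.stageCost x u)
    (hP : D.lq.IsValue P) (horb : ∀ x, Tendsto (D.lq.orbit P x) atTop (𝓝 0))
    {v : (Fin n → ℝ) → ℝ} (hv0 : ∀ x, 0 ≤ v x)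
    (hv : MemWeighted quadWeight v) (hfix : D.bellman v = v) :
    v = value P (D.γ * D.noiseCost P / (1 - D.γ)) := by
  set w := value P (D.γ * D.noiseCost P / (1 - D.γ)) with hw
  have hwm : MemWeighted quadWeight w := memWeighted_value _ _
  obtain ⟨-, C, hC⟩ := memWeighted_iff.1 hv
  set E := D.lq.closedLoop (D.lq.gain P) with hE
  -- `value (q N) (s N)` is the majorant `C * quadWeight` propagated `N` steps along the greedy
  -- closed loop, discount included; `s` collects the noise.
  let q : ℕ → Matrix (Fin n ⊕ Unit) (Fin n ⊕ Unit) ℝ := fun N => (E ^ N)ᵀ * (C • 1) * E ^ N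
  have hqsymm : ∀ N, (q N).IsSymm := fun N => isSymm_conj (isSymm_one.smul C) _
  have hqsucc : ∀ N, q (N + 1) = Eᵀ * q N * E := fun N => by
    simp only [q, pow_succ, transpose_mul, Matrix.mul_assoc]
  let s : ℕ → ℝ := fun N => Nat.rec 0 (fun N a => D.γ * (a + D.noiseCost (q N))) N
  have hE0 : Tendsto (fun N => E ^ N) atTop (𝓝 0) := by
    -- The columns of `E ^ N` are the orbits of the basis vectors.
    refine tendsto_pi_nhds.2 fun i => tendsto_pi_nhds.2 fun j => ?_
    have := tendsto_pi_nhds.1 (horb (Pi.single j 1)) i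
    simpa [LinQuad.orbit, ← hE] using this
  have hq0 : Tendsto q atTop (𝓝 0) := by
    have hc : Continuous fun M : Matrix (Fin n ⊕ Unit) (Fin n ⊕ Unit) ℝ => Mᵀ * (C • 1) * M := by
      fun_prop
    have := (hc.tendsto 0).comp hE0
    rwa [Matrix.mul_zero] at this
  have hs0 : Tendsto s atTop (𝓝 0) := by
    have h1 := tendsto_of_affine_recursion hγ0 hγ1 (s := s) (fun _ => rfl)
      (((continuous_noiseCost (D := D)).tendsto 0).comp hq0)
    have h2 : D.noiseCost 0 = 0 := by simp [noiseCost, toBlocks₁₁, trace, mul_apply]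
    simpa [h2] using h1
  -- The greedy input for `w` attains the minimum for `w` but is only a competitor for `v`; the
  -- stage costs cancel.
  have hstep : ∀ x, v x - w x ≤ D.γ * ∫ y, (v (D.step x (D.lq.gain P *ᵥ lift x) y)
      - w (D.step x (D.lq.gain P *ᵥ lift x) y)) ∂(D.noise : Measure (Fin n → ℝ)) := by
    intro x
    have h1 := bellman_le_lookahead hγ0 hcost hv0 x (D.lq.gain P *ᵥ lift x)
    have h2 := lookahead_value_eq hnoise hγ0 hγ1 hL hP x
    rw [hfix, lookahead] at h1
    rw [← hw, lookahead] at h2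
    rw [integral_sub (integrable_of_memWeighted hnoise hv x _)
      (integrable_of_memWeighted hnoise hwm x _), mul_sub]
    linarith
  have hbound : ∀ N x, v x - w x ≤ value (q N) (s N) x := by
    intro N
    induction N with
    | zero =>
      intro x
      have h1 := (le_abs_self _).trans (hC x)
      have h2 := value_nonneg hnoise hγ0 hγ1 (hP.posSemidef hL) x
      have h3 : value (q 0) (s 0) x = C * quadWeight x := by
        rw [← value_smul_one]
        simp [q, s]
      rw [h3, hw]
      linarith
    | succ N ih =>
      intro x
      have h1 : value (q (N + 1)) (s (N + 1)) x = D.γ * ∫ y, value (q N) (s N)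
          (D.step x (D.lq.gain P *ᵥ lift x) y) ∂(D.noise : Measure (Fin n → ℝ)) := by
        rw [discounted_integral_value hnoise hγ0 (hqsymm N), ← LinQuad.closedLoop_mulVec, ← hE,
          ← form_conj, ← hqsucc, value]
      rw [h1]
      refine (hstep x).trans (mul_le_mul_of_nonneg_left (integral_mono ?_ ?_ fun y => ih _) hγ0)
      · exact (integrable_of_memWeighted hnoise hv x _).sub
          (integrable_of_memWeighted hnoise hwm x _)
      · exact integrable_of_memWeighted hnoise (memWeighted_value _ _) x _
  ext x
  refine le_antisymm ?_ (value_le_of_bellman_eq hnoise hγ0 hγ1 hL hP hv0 hv hfix x)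
  have hlim := tendsto_value hq0 hs0 x
  have h0 : value (0 : Matrix (Fin n ⊕ Unit) (Fin n ⊕ Unit) ℝ) 0 x = 0 := by simp [value]
  rw [h0] at hlim
  exact sub_nonpos.1 (ge_of_tendsto' hlim fun N => hbound N x)

end Value

end Data

/-! ### The cost of a policy -/

/-- Prepend a term to a sequence. -/
def seqCons {α : Type*} (p : α × (ℕ → α)) : ℕ → α := fun k => Nat.casesOn k p.1 p.2

theorem measurable_seqCons {α : Type*} [MeasurableSpace α] :
    Measurable (seqCons : α × (ℕ → α) → ℕ → α) := by
  refine measurable_pi_lambda _ fun k => ?_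
  cases k with
  | zero => exact measurable_fst
  | succ k => exact (measurable_pi_apply k).comp measurable_snd

/-- Prepending an independent sample to an i.i.d. sequence gives an i.i.d. sequence. -/
theorem measurePreserving_seqCons {α : Type*} [MeasurableSpace α] (μ : Measure α)
    [IsProbabilityMeasure μ] :
    MeasurePreserving seqCons (μ.prod (Measure.infinitePi fun _ : ℕ => μ))
      (Measure.infinitePi fun _ : ℕ => μ) := by
  refine ⟨measurable_seqCons, Measure.eq_infinitePi _ fun s t ht => ?_⟩
  classical
  obtain ⟨N, hN⟩ := s.exists_nat_subset_range
  have hsub : s ⊆ Finset.range (N + 1) := hN.trans (Finset.range_subset_range.2 N.le_succ)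
  -- Padding with the whole space turns the box over `s` into one over an initial segment, where the
  -- shift of indices is harmless.
  let t' : ℕ → Set α := fun i => if i ∈ s then t i else Set.univ
  have ht' : ∀ i, MeasurableSet (t' i) := fun i => by
    simp only [t']
    split_ifs
    exacts [ht i, MeasurableSet.univ]
  have hpre : seqCons ⁻¹' (Set.pi s t)
      = t' 0 ×ˢ Set.pi (Finset.range N) (fun i => t' (i + 1)) := by
    ext ⟨y, ω⟩
    simp only [Set.mem_preimage, Set.mem_pi, Set.mem_prod, Finset.mem_coe, Finset.mem_range, t']
    constructor
    · intro h
      refine ⟨?_, fun i _ => ?_⟩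
      · split_ifs with h0
        exacts [h 0 h0, trivial]
      · split_ifs with h0
        exacts [h (i + 1) h0, trivial]
    · rintro ⟨h0, h1⟩ i hi
      cases i with
      | zero => simpa [hi, seqCons] using h0
      | succ i =>
        have := h1 i (by have := Finset.mem_range.1 (hN hi); omega)
        simpa [hi, seqCons] using this
  have hs : MeasurableSet (Set.pi (s : Set ℕ) t) :=
    MeasurableSet.pi s.countable_toSet fun i _ => ht i
  rw [Measure.map_apply measurable_seqCons hs, hpre, Measure.prod_prod,
    Measure.infinitePi_pi _ fun i _ => ht' (i + 1), mul_comm,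
    ← Finset.prod_range_succ' (fun i => μ (t' i)) N]
  refine (Finset.prod_subset hsub fun i _ hi => ?_).symm.trans
    (Finset.prod_congr rfl fun i hi => ?_)
  · simp [t', hi]
  · simp [t', hi]

namespace Data

variable {n m : ℕ} {D : Data n m}

theorem measurable_stageCost {α : Type*} [MeasurableSpace α] {f : α → Fin n → ℝ}
    {g : α → Fin m → ℝ} (hf : Measurable f) (hg : Measurable g) :
    Measurable fun a => D.stageCost (f a) (g a) := by
  have hc : Continuous fun p : (Fin n → ℝ) × (Fin m → ℝ) => D.stageCost p.1 p.2 := by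
    simp only [stageCost_eq]
    fun_prop
  exact hc.measurable.comp (hf.prodMk hg)

theorem measurable_step_comp {α : Type*} [MeasurableSpace α] {f h : α → Fin n → ℝ}
    {g : α → Fin m → ℝ} (hf : Measurable f) (hg : Measurable g) (hh : Measurable h) :
    Measurable fun a => D.step (f a) (g a) (h a) := by
  have hA : Continuous fun x : Fin n → ℝ => D.A *ᵥ x := by fun_prop
  have hB : Continuous fun u : Fin m → ℝ => D.B *ᵥ u := by fun_prop
  exact (((hA.measurable.comp hf).add (hB.measurable.comp hg)).add_const D.c).add hh

theorem traj_seqCons_succ (π : (Fin n → ℝ) → (Fin m → ℝ)) (x y : Fin n → ℝ)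
    (ω : ℕ → Fin n → ℝ) (k : ℕ) :
    D.traj π x (seqCons (y, ω)) (k + 1) = D.traj π (D.step x (π x) y) ω k := by
  induction k with
  | zero => rfl
  | succ k ih => rw [traj, ih]; rfl

/-! ### Finite-horizon costs and optimality. -/

section Policy

variable {π : (Fin n → ℝ) → (Fin m → ℝ)}

theorem measurable_traj {α : Type*} [MeasurableSpace α] {f : α → Fin n → ℝ}
    {g : α → ℕ → Fin n → ℝ} (hπ : Measurable π) (hf : Measurable f) (hg : Measurable g) (k : ℕ) :
    Measurable fun a => D.traj π (f a) (g a) k := by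
  induction k with
  | zero => exact hf
  | succ k ih =>
    have hu : Measurable fun a => π (D.traj π (f a) (g a) k) := hπ.comp ih
    have hω : Measurable fun a => g a k := (measurable_pi_apply k).comp hg
    simp only [traj]
    exact measurable_step_comp ih hu hω

theorem measurable_stageCost_traj {α : Type*} [MeasurableSpace α] {f : α → Fin n → ℝ}
    {g : α → ℕ → Fin n → ℝ} (hπ : Measurable π) (hf : Measurable f) (hg : Measurable g) (k : ℕ) :
    Measurable fun a => ENNReal.ofReal
      (D.γ ^ k * D.stageCost (D.traj π (f a) (g a) k) (π (D.traj π (f a) (g a) k))) := by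
  have h := measurable_traj (D := D) hπ hf hg k
  refine Measurable.ennreal_ofReal (Measurable.const_mul (measurable_stageCost h ?_) _)
  exact hπ.comp h

/-- The expected discounted cost of a policy over the first `N` steps. -/
noncomputable def partialCost (D : Data n m) (π : (Fin n → ℝ) → (Fin m → ℝ)) (N : ℕ)
    (x : Fin n → ℝ) : ENNReal :=
  ∫⁻ ω, ∑ k ∈ Finset.range N,
      ENNReal.ofReal (D.γ ^ k * D.stageCost (D.traj π x ω k) (π (D.traj π x ω k)))
    ∂(Measure.infinitePi fun _ : ℕ => (D.noise : Measure (Fin n → ℝ)))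

/-- Splitting off the first noise sample leaves an i.i.d. sequence that drives the same policy from
the next state. In `[0, ∞]` this needs no integrability. -/
theorem partialCost_succ (hγ : 0 ≤ D.γ) (hπ : Measurable π) (N : ℕ) (x : Fin n → ℝ) :
    D.partialCost π (N + 1) x = ENNReal.ofReal (D.stageCost x (π x))
      + ENNReal.ofReal D.γ * ∫⁻ y, D.partialCost π N (D.step x (π x) y)
          ∂(D.noise : Measure (Fin n → ℝ)) := by
  have hm : ∀ N, Measurable fun p : (Fin n → ℝ) × (ℕ → Fin n → ℝ) => ∑ k ∈ Finset.range N,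
      ENNReal.ofReal (D.γ ^ k * D.stageCost (D.traj π p.1 p.2 k) (π (D.traj π p.1 p.2 k))) :=
    fun N => Finset.measurable_sum _ fun k _ =>
      measurable_stageCost_traj hπ measurable_fst measurable_snd k
  have hsplit : ∀ (y : Fin n → ℝ) (ω : ℕ → Fin n → ℝ), ∑ k ∈ Finset.range (N + 1),
      ENNReal.ofReal (D.γ ^ k * D.stageCost (D.traj π x (seqCons (y, ω)) k)
        (π (D.traj π x (seqCons (y, ω)) k)))
      = ENNReal.ofReal (D.stageCost x (π x)) + ENNReal.ofReal D.γ * ∑ k ∈ Finset.range N,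
        ENNReal.ofReal (D.γ ^ k * D.stageCost (D.traj π (D.step x (π x) y) ω k)
          (π (D.traj π (D.step x (π x) y) ω k))) := by
    intro y ω
    rw [Finset.sum_range_succ', add_comm, Finset.mul_sum]
    congr 1
    · simp [traj]
    · refine Finset.sum_congr rfl fun k _ => ?_
      rw [traj_seqCons_succ, ← ENNReal.ofReal_mul hγ, ← mul_assoc, ← pow_succ']
  have hm' : ∀ N z, Measurable fun ω : ℕ → Fin n → ℝ => ∑ k ∈ Finset.range N,
      ENNReal.ofReal (D.γ ^ k * D.stageCost (D.traj π z ω k) (π (D.traj π z ω k))) :=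
    fun N z => Finset.measurable_sum _ fun k _ =>
      measurable_stageCost_traj hπ measurable_const measurable_id k
  rw [partialCost, ← (measurePreserving_seqCons (D.noise : Measure (Fin n → ℝ))).lintegral_comp
    (hm' (N + 1) x), lintegral_prod _ (Finset.measurable_sum _ fun k _ =>
      measurable_stageCost_traj hπ measurable_const measurable_seqCons k).aemeasurable]
  simp only [hsplit]
  have hp : Measurable fun y => D.partialCost π N (D.step x (π x) y) :=
    (hm N).lintegral_prod_right'.comp (measurable_step x (π x))
  calc _ = ∫⁻ y, (ENNReal.ofReal (D.stageCost x (π x))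
        + ENNReal.ofReal D.γ * D.partialCost π N (D.step x (π x) y))
          ∂(D.noise : Measure (Fin n → ℝ)) := by
        refine lintegral_congr fun y => ?_
        rw [lintegral_add_left measurable_const, lintegral_const_mul _ (hm' _ _), lintegral_const,
          measure_univ, mul_one, partialCost]
    _ = _ := by
        rw [lintegral_add_left measurable_const, lintegral_const_mul _ hp, lintegral_const,
          measure_univ, mul_one]

theorem partialCost_le_policyCost (N : ℕ) (x : Fin n → ℝ) :
    D.partialCost π N x ≤ D.policyCost π x :=
  lintegral_mono fun _ => ENNReal.sum_le_tsum _

theorem policyCost_le (hπ : Measurable π) {x : Fin n → ℝ} {a : ENNReal}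
    (h : ∀ N, D.partialCost π N x ≤ a) : D.policyCost π x ≤ a := by
  have hm : ∀ k, Measurable fun ω : ℕ → Fin n → ℝ =>
      ENNReal.ofReal (D.γ ^ k * D.stageCost (D.traj π x ω k) (π (D.traj π x ω k))) :=
    fun k => measurable_stageCost_traj hπ measurable_const measurable_id k
  rw [policyCost, lintegral_tsum fun k => (hm k).aemeasurable, ENNReal.tsum_eq_iSup_nat]
  refine iSup_le fun N => ?_
  rw [← lintegral_finsetSum _ fun k _ => hm k]
  exact h N

theorem ofReal_lookahead
    (hnoise : MemLp (fun y : Fin n → ℝ => y) 2 (D.noise : Measure (Fin n → ℝ)))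
    (hγ : 0 ≤ D.γ) (hcost : ∀ x u, 0 ≤ D.stageCost x u)
    {v : (Fin n → ℝ) → ℝ} (hv0 : ∀ x, 0 ≤ v x) (hv : MemWeighted quadWeight v) (x : Fin n → ℝ)
    (u : Fin m → ℝ) :
    ENNReal.ofReal (D.lookahead v x u) = ENNReal.ofReal (D.stageCost x u)
      + ENNReal.ofReal D.γ * ∫⁻ y, ENNReal.ofReal (v (D.step x u y))
          ∂(D.noise : Measure (Fin n → ℝ)) := by
  rw [lookahead, ENNReal.ofReal_add (hcost x u) (mul_nonneg hγ (integral_nonneg fun _ => hv0 _)),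
    ENNReal.ofReal_mul hγ, ofReal_integral_eq_lintegral_ofReal
      (integrable_of_memWeighted hnoise hv x u) (Eventually.of_forall fun _ => hv0 _)]

theorem ofReal_value_iter_le_partialCost
    (hnoise : MemLp (fun y : Fin n → ℝ => y) 2 (D.noise : Measure (Fin n → ℝ)))
    (hγ : 0 ≤ D.γ) (hL : D.lq.Admissible)
    (hcost : ∀ x u, 0 ≤ D.stageCost x u) (hπ : Measurable π) (N : ℕ) (x : Fin n → ℝ) :
    ENNReal.ofReal (value (D.lq.iter N) (D.offset N) x) ≤ D.partialCost π N x := by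
  induction N generalizing x with
  | zero => simp [value, LinQuad.iter, offset]
  | succ N ih =>
    refine (ENNReal.ofReal_le_ofReal
      (value_iter_succ_le_lookahead hnoise hγ hL N x (π x))).trans ?_
    rw [ofReal_lookahead hnoise hγ hcost (value_iter_nonneg hnoise hγ hL N)
      (memWeighted_value _ _), partialCost_succ hγ hπ]
    gcongr
    exact ih _

variable {P : Matrix (Fin n ⊕ Unit) (Fin n ⊕ Unit) ℝ}

theorem ofReal_value_le_policyCost
    (hnoise : MemLp (fun y : Fin n → ℝ => y) 2 (D.noise : Measure (Fin n → ℝ)))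
    (hγ0 : 0 ≤ D.γ) (hγ1 : D.γ < 1) (hL : D.lq.Admissible)
    (hcost : ∀ x u, 0 ≤ D.stageCost x u) (hP : D.lq.IsValue P) (hπ : Measurable π)
    (x : Fin n → ℝ) :
    ENNReal.ofReal (value P (D.γ * D.noiseCost P / (1 - D.γ)) x) ≤ D.policyCost π x :=
  le_of_tendsto' (ENNReal.tendsto_ofReal (tendsto_value_iter hγ0 hγ1 hP x)) fun N =>
    (ofReal_value_iter_le_partialCost hnoise hγ0 hL hcost hπ N x).trans
      (partialCost_le_policyCost N x)

/-- The value is non-negative and reproduced by the lookahead at the greedy input, so by induction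
it dominates every finite-horizon cost. Stability of the closed loop plays no role. -/
theorem policyCost_gain_le
    (hnoise : MemLp (fun y : Fin n → ℝ => y) 2 (D.noise : Measure (Fin n → ℝ)))
    (hγ0 : 0 ≤ D.γ) (hγ1 : D.γ < 1) (hL : D.lq.Admissible)
    (hcost : ∀ x u, 0 ≤ D.stageCost x u) (hP : D.lq.IsValue P)
    (hπ : Measurable fun x => D.lq.gain P *ᵥ lift x) (x : Fin n → ℝ) :
    D.policyCost (fun x => D.lq.gain P *ᵥ lift x) x
      ≤ ENNReal.ofReal (value P (D.γ * D.noiseCost P / (1 - D.γ)) x) := by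
  refine policyCost_le hπ fun N => ?_
  induction N generalizing x with
  | zero => simp [partialCost]
  | succ N ih =>
    rw [partialCost_succ hγ0 hπ, ← lookahead_value_eq hnoise hγ0 hγ1 hL hP x,
      ofReal_lookahead hnoise hγ0 hcost (value_nonneg hnoise hγ0 hγ1 (hP.posSemidef hL))
        (memWeighted_value _ _)]
    gcongr
    exact ih _

end Policy

end Data

end AffineLQ

end

/-! ### The main theorem. -/

theorem proposition1 {n m : ℕ} (D : AffineLQ.Data n m)
    (hγ0 : 0 < D.γ) (hγ1 : D.γ < 1)
    (hnoise : MemLp (fun y : Fin n → ℝ => y) 2 (D.noise : Measure (Fin n → ℝ)))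
    (hstab : AffineLQ.IsStabilizable (√D.γ • D.A) (√D.γ • D.B))
    (hLxx : D.Lxx.IsSymm) (hLuu : D.Luu.PosDef)
    (hcost : ∀ x u, 0 ≤ D.stageCost x u) :
    ∃ (P : Matrix (Fin n) (Fin n) ℝ) (p : Fin n → ℝ) (r : ℝ),
      -- the augmented matrix is the least positive semidefinite solution of the augmented ARE
      (AffineLQ.Data.blockSym P p r).PosSemidef ∧
      D.SolvesARE (AffineLQ.Data.blockSym P p r) ∧
      (∀ P', P'.PosSemidef → D.SolvesARE P' → (P' - AffineLQ.Data.blockSym P p r).PosSemidef) ∧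
      -- uniqueness of the solution, and its positive definiteness
      (D.CostDetectable →
        ∀ P', P'.PosSemidef → D.SolvesARE P' → P' = AffineLQ.Data.blockSym P p r) ∧
      ((AffineLQ.Data.blockSym P p r).PosDef ↔ D.AugCostObservable) ∧
      ((AffineLQ.Data.blockSym P p r).PosDef →
        ∀ P', P'.PosSemidef → D.SolvesARE P' → P' = AffineLQ.Data.blockSym P p r) ∧
      -- the quadratic function is the fixed point of the Bellman operator
      (∀ x, 0 ≤ D.quadValue P p r x) ∧
      AffineLQ.MemWeighted AffineLQ.quadWeight (D.quadValue P p r) ∧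
      D.bellman (D.quadValue P p r) = D.quadValue P p r ∧
      (∀ v : (Fin n → ℝ) → ℝ, (∀ x, 0 ≤ v x) → AffineLQ.MemWeighted AffineLQ.quadWeight v →
        D.bellman v = v → ∀ x, D.quadValue P p r x ≤ v x) ∧
      (D.CostDetectable →
        ∀ v : (Fin n → ℝ) → ℝ, (∀ x, 0 ≤ v x) → AffineLQ.MemWeighted AffineLQ.quadWeight v →
          D.bellman v = v → v = D.quadValue P p r) ∧
      -- it is the optimal value function
      (∀ x, D.optimalCost x = ENNReal.ofReal (D.quadValue P p r x)) ∧
      -- the affine feedback is well defined, greedy, and optimal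
      (D.qc P).PosDef ∧
      (∀ x u, (∀ w, D.lookahead (D.quadValue P p r) x u ≤ D.lookahead (D.quadValue P p r) x w) ↔
        u = D.affPolicy P p x) ∧
      Measurable (D.affPolicy P p) ∧
      (∀ x, D.policyCost (D.affPolicy P p) x = D.optimalCost x) := by
  have hγ := hγ0.le
  have hL := AffineLQ.Data.lq_admissible hLxx hLuu hcost
  -- The witnesses `P`, `p`, `r` are the blocks of the limit of value iteration.
  obtain ⟨M, hM⟩ : ∃ M, D.lq.IsValue M :=
    hL.exists_tendsto_iter (AffineLQ.Data.lq_isStabilizable hγ1 hstab)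
  have hMpos := hM.posSemidef hL
  obtain ⟨P, p, r, rfl⟩ := AffineLQ.Data.exists_eq_blockSym hMpos.isSymm
  have hPsymm : P.IsSymm := (hMpos.submatrix Sum.inl).isSymm
  have hval : D.quadValue P p r = AffineLQ.Data.value (AffineLQ.Data.blockSym P p r)
      (D.γ * D.noiseCost (AffineLQ.Data.blockSym P p r) / (1 - D.γ)) := by
    ext x
    rw [AffineLQ.Data.value_blockSym]
    rfl
  have hpol : D.affPolicy P p = fun x =>
      D.lq.gain (AffineLQ.Data.blockSym P p r) *ᵥ AffineLQ.lift x :=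
    funext fun x => AffineLQ.Data.affPolicy_eq hγ hPsymm p r x
  have hmeas : Measurable (D.affPolicy P p) := by
    have hc : Continuous (D.affPolicy P p) := by
      unfold AffineLQ.Data.affPolicy
      fun_prop
    exact hc.measurable
  have horb : D.CostDetectable → ∀ x, Filter.Tendsto
      (D.lq.orbit (AffineLQ.Data.blockSym P p r) x) Filter.atTop (nhds 0) := fun hdet =>
    hM.tendsto_orbit_of_detectable hL (AffineLQ.Data.lq_isDetectable hγ1 hdet)
  have hle : ∀ x, D.policyCost (D.affPolicy P p) x ≤ ENNReal.ofReal (D.quadValue P p r x) := by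
    rw [hval, hpol]
    exact AffineLQ.Data.policyCost_gain_le hnoise hγ hγ1 hL hcost hM (hpol ▸ hmeas)
  have hopt : ∀ x, D.optimalCost x = ENNReal.ofReal (D.quadValue P p r x) := fun x =>
    le_antisymm ((iInf₂_le _ hmeas).trans (hle x)) (le_iInf₂ fun π hπ => by
      rw [hval]
      exact AffineLQ.Data.ofReal_value_le_policyCost hnoise hγ hγ1 hL hcost hM hπ x)
  refine ⟨P, p, r, hMpos, (AffineLQ.Data.solvesARE_iff hγ).2 (hM.eq_riccati hL),
    fun P' hP' hfix => hM.sub_posSemidef_of_fixed hL hP' ((AffineLQ.Data.solvesARE_iff hγ).1 hfix),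
    fun hdet P' hP' hfix =>
      hM.eq_of_fixed hL (horb hdet) hP' ((AffineLQ.Data.solvesARE_iff hγ).1 hfix),
    ?_, fun hpos P' hP' hfix => hM.eq_of_fixed hL (hM.tendsto_orbit_of_posDef hL hpos) hP'
      ((AffineLQ.Data.solvesARE_iff hγ).1 hfix),
    ?_, ?_, ?_, ?_, ?_, hopt, ?_, ?_, hmeas, fun x => ?_⟩
  · rw [hM.posDef_iff_isObservable hL, AffineLQ.Data.lq_reducedDynamics]
    rfl
  · rw [hval]
    exact AffineLQ.Data.value_nonneg hnoise hγ hγ1 hMpos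
  · rw [hval]
    exact AffineLQ.Data.memWeighted_value _ _
  · rw [hval]
    exact AffineLQ.Data.bellman_value_eq hnoise hγ hγ1 hL hM
  · rw [hval]
    exact fun v hv0 hv hfix =>
      AffineLQ.Data.value_le_of_bellman_eq hnoise hγ hγ1 hL hM hv0 hv hfix
  · rw [hval]
    exact fun hdet v hv0 hv hfix =>
      AffineLQ.Data.eq_value_of_bellman_eq hnoise hγ hγ1 hL hcost hM (horb hdet) hv0 hv hfix
  · rw [← AffineLQ.Data.lq_qu_blockSym hγ P p r]
    exact hL.qu_posDef hMpos
  · rw [hval, hpol]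
    exact AffineLQ.Data.lookahead_value_le_iff hnoise hγ hL hMpos _
  · exact le_antisymm ((hle x).trans_eq (hopt x).symm) (iInf₂_le _ hmeas)
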